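/- For a finite set $P\subset\mathbb{R}^d$ let $\mathcal{R}_d(P)=\{R\cap P\}$, where $R$ ranges over all axis-parallel boxes $R=[a_1,b_1]\times\cdots\times[a_d,b_d]$, and let $$\operatorname{disc}\mathcal{R}_d(P)=\min_{x:P\to\{-1,1\}}\ \max_{F\in\mathcal{R}_d(P)}\Bigl|\sum_{p\in F}x(p)\Bigr|$$ be its combinatorial discrepancy. Let $d\ge 2$. Then: (i) there is a constant $c=c(d)>0$, depending only on $d$, such that for infinitely many $n$ there exists an $n$-point set $P\subset\mathbb{R}^d$ with $\operatorname{disc}\mathcal{R}_d(P)\ge c\,(\log n)^{d-1}$; (ii) there is a constant $C=C(d)>0$, depending only on $d$, such that for every $n\ge 2$ every $n$-point set $P\subset\mathbb{R}^d$ satisfies $\operatorname{disc}\mathcal{R}_d(P)\le C\,(\log n)^{d+1/2}$; that is, $\operatorname{disc}(n,\mathcal{R}_d):=\max_{|P|=n}\operatorname{disc}\mathcal{R}_d(P)=O(\log^{d+1/2}n)$. -/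

import Mathlib

/-- The discrepancy `disc(𝓕, x)` of a finite set system `𝓕` under the coloring `x`: the maximum
over `F ∈ 𝓕` of `|∑ j ∈ F, x j|`. A coloring assigns to each point a sign `1` or `-1`, i.e. a
unit of `ℤ`. -/
def coloringDisc {α : Type*} (𝓕 : Finset (Finset α)) (x : α → ℤˣ) : ℕ :=
  𝓕.sup fun F => (∑ j ∈ F, (x j : ℤ)).natAbs

/-- The discrepancy `disc 𝓕` of a finite set system: the minimum of `disc(𝓕, x)` over all
colorings `x` of the points. (Only the signs of points lying in some member of `𝓕` matter, so it
is harmless that all points of the ambient type are colored.) -/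
noncomputable def disc {α : Type*} (𝓕 : Finset (Finset α)) : ℕ :=
  ⨅ x : α → ℤˣ, coloringDisc 𝓕 x

/-- The family of all axis-parallel boxes `[a₁, b₁] × ⋯ × [a_d, b_d]` in `ℝ^d`. -/
def axisBoxes (d : ℕ) : Set (Set (Fin d → ℝ)) :=
  {R | ∃ a b : Fin d → ℝ, (∀ i, a i ≤ b i) ∧ R = {p | ∀ i, p i ∈ Set.Icc (a i) (b i)}}

open Classical in
/-- The system `{R ∩ P : R an axis-parallel box}` of all subsets of the finite point set `P`
induced by axis-parallel boxes. -/
noncomputable def inducedBoxes {d : ℕ} (P : Finset (Fin d → ℝ)) : Finset (Finset (Fin d → ℝ)) :=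
  P.powerset.filter fun S => ∃ R ∈ axisBoxes d, (S : Set (Fin d → ℝ)) = R ∩ (P : Set (Fin d → ℝ))

/-! Upper bound. Coordinates matter only through ranks, so K ≈ log₂ n dyadic levels suffice. A point
becomes the incidence vector of the dyadic intervals around each of its coordinates, tensored over
the d directions. A box becomes the tensor product of differences of two canonical prefix
decompositions. The inner product of the two is the indicator of "point in box", and both norms are
at most (2K)^(d/2). The Gram–Schmidt walk signs any vectors of norm at most one so that the signed
sum is subgaussian in every direction (`exists_subgaussian_signing`). A union bound over the at most
(n+1)^(2d) pairs of rank vectors then costs one factor √(log n), giving (2K)^d √(log n) up to a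
constant (`disc_inducedBoxes_le_of_card_lt_two_pow`).

Lower bound. Let d = e + 1, S = eT, and take the grid of side N = 2^(S+2). Let D be the largest
discrepancy of a subset of the grid. The incidence matrix A of grid points against boxes anchored at
0 then has hereditary discrepancy at most D, so each of its k × k minors is at most (4D)^k
(`abs_det_le_of_forall_signing`). For matrices U, V with k orthogonal columns of squared norm β,
Cauchy–Binet and Cauchy–Schwarz turn this into k! |det(VᵀAU)| ≤ (4D N^d β)^k. U consists of products
of Haar functions and V of products of Walsh-type functions, with levels summing to S. Applying A
integrates Haar functions into tents, and the Walsh functions are built so that VᵀAU is a scalar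
matrix. There are k ≥ (T+1)^e 2^(Se) index vectors, where (T+1)^e counts distributions of the level
S over the coordinates. Since k! ≥ (k/e)^k with Euler's e, all powers of 2^S cancel and (T+1)^(d-1)
= O(D), while log of the number of points is O(T). -/

/-! ### Exponential moments of a sign with prescribed mean -/

/-- The moment generating function `E exp (a (X - s))` of a `±1`-valued random variable `X` with
mean `s`. -/
noncomputable def signMGF (s a : ℝ) : ℝ :=
  Real.exp (-(a * s)) * (Real.cosh a + s * Real.sinh a)

theorem signMGF_neg_neg (s a : ℝ) : signMGF (-s) (-a) = signMGF s a := by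
  simp [signMGF]

theorem signMGF_zero (s : ℝ) : signMGF s 0 = 1 := by simp [signMGF]

theorem signMGF_one (a : ℝ) : signMGF 1 a = 1 := by
  simp [signMGF, Real.cosh_add_sinh, ← Real.exp_add]

theorem signMGF_neg_one (a : ℝ) : signMGF (-1) a = 1 := by
  have h := signMGF_neg_neg 1 (-a)
  rw [neg_neg, signMGF_one] at h
  exact h

theorem hasDerivAt_signMGF (s a : ℝ) :
    HasDerivAt (signMGF s) (Real.exp (-(a * s)) * ((1 - s ^ 2) * Real.sinh a)) a := by
  have h1 : HasDerivAt (fun a : ℝ => Real.exp (-(a * s))) (Real.exp (-(a * s)) * (-(1 * s))) a :=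
    (((hasDerivAt_id a).mul_const s).neg).exp
  have h2 : HasDerivAt (fun a : ℝ => Real.cosh a + s * Real.sinh a)
      (Real.sinh a + s * Real.cosh a) a :=
    (Real.hasDerivAt_cosh a).add ((Real.hasDerivAt_sinh a).const_mul s)
  refine (h1.mul h2).congr_deriv ?_
  ring

theorem signMGF_monotoneOn {s : ℝ} (hs : s ^ 2 ≤ 1) : MonotoneOn (signMGF s) (Set.Ici 0) := by
  refine monotoneOn_of_deriv_nonneg (convex_Ici 0)
    (fun a _ => (hasDerivAt_signMGF s a).continuousAt.continuousWithinAt)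
    (fun a _ => (hasDerivAt_signMGF s a).differentiableAt.differentiableWithinAt) ?_
  intro a ha
  rw [interior_Ici, Set.mem_Ioi] at ha
  rw [(hasDerivAt_signMGF s a).deriv]
  have := Real.sinh_nonneg_iff.2 ha.le
  have : 0 ≤ 1 - s ^ 2 := by linarith
  positivity

theorem sinh_le_self_mul_cosh {a : ℝ} (ha : 0 ≤ a) : Real.sinh a ≤ a * Real.cosh a := by
  have hmono : MonotoneOn (fun a : ℝ => a * Real.cosh a - Real.sinh a) (Set.Ici 0) := by
    have hd (x : ℝ) : HasDerivAt (fun a : ℝ => a * Real.cosh a - Real.sinh a)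
        (x * Real.sinh x) x := by
      refine (((hasDerivAt_id x).mul (Real.hasDerivAt_cosh x)).sub
        (Real.hasDerivAt_sinh x)).congr_deriv ?_
      simp
    refine monotoneOn_of_deriv_nonneg (convex_Ici 0)
      (fun x _ => (hd x).continuousAt.continuousWithinAt)
      (fun x _ => (hd x).differentiableAt.differentiableWithinAt) ?_
    intro x hx
    rw [interior_Ici, Set.mem_Ioi] at hx
    rw [(hd x).deriv]
    have := Real.sinh_nonneg_iff.2 hx.le
    positivity
  have := hmono (Set.mem_Ici.2 le_rfl) (Set.mem_Ici.2 ha) ha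
  simpa using this

/-- The sign of the derivative reduces to (1 - s²) sinh a ≤ 2a (cosh a + s sinh a). This follows
from sinh a ≤ a cosh a and (1 - s²) cosh a ≤ 2 (cosh a + s sinh a); for s < 0 the latter uses cosh a
+ s sinh a ≥ (1 + s) cosh a. -/
theorem signMGF_mul_exp_antitoneOn {s : ℝ} (hs : |s| ≤ 1) :
    AntitoneOn (fun a => signMGF s a * Real.exp (-a ^ 2)) (Set.Ici 0) := by
  have hd (a : ℝ) : HasDerivAt (fun a => signMGF s a * Real.exp (-a ^ 2))
      (Real.exp (-(a * s)) * ((1 - s ^ 2) * Real.sinh a) * Real.exp (-a ^ 2) +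
        signMGF s a * (Real.exp (-a ^ 2) * (-(2 * a)))) a := by
    refine (hasDerivAt_signMGF s a).mul ?_
    have h : HasDerivAt (fun a : ℝ => -a ^ 2) (-(2 * a)) a := by
      simpa using (hasDerivAt_pow 2 a).fun_neg
    exact h.exp
  refine antitoneOn_of_deriv_nonpos (convex_Ici 0)
    (fun a _ => (hd a).continuousAt.continuousWithinAt)
    (fun a _ => (hd a).differentiableAt.differentiableWithinAt) ?_
  intro a ha
  rw [interior_Ici, Set.mem_Ioi] at ha
  rw [(hd a).deriv]
  obtain ⟨hs1, hs2⟩ := abs_le.1 hs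
  have hsinh := Real.sinh_nonneg_iff.2 ha.le
  have hsc : Real.sinh a ≤ Real.cosh a := (Real.sinh_lt_cosh a).le
  have hsa := sinh_le_self_mul_cosh ha.le
  have hcosh := Real.cosh_pos a
  have key : (1 - s ^ 2) * Real.sinh a ≤ 2 * a * (Real.cosh a + s * Real.sinh a) := by
    have hss : (1 - s ^ 2) * Real.sinh a ≤ (1 - s ^ 2) * (a * Real.cosh a) :=
      mul_le_mul_of_nonneg_left hsa (by nlinarith)
    have h2 : (1 - s ^ 2) * Real.cosh a ≤ 2 * (Real.cosh a + s * Real.sinh a) := by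
      rcases le_total 0 s with h | h
      · nlinarith [mul_nonneg h hsinh, mul_nonneg (mul_self_nonneg s) hcosh.le]
      · nlinarith [mul_nonneg (neg_nonneg.2 h) (sub_nonneg.2 hsc),
          mul_nonneg (mul_self_nonneg (1 + s)) hcosh.le]
    nlinarith [mul_le_mul_of_nonneg_left h2 ha.le]
  have e1 := Real.exp_pos (-(a * s))
  have e2 := Real.exp_pos (-a ^ 2)
  have := mul_le_mul_of_nonneg_left key (mul_pos e1 e2).le
  simp only [signMGF]
  nlinarith

theorem one_le_signMGF {s a : ℝ} (hs : |s| ≤ 1) : 1 ≤ signMGF s a := by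
  have key {s a : ℝ} (hs : |s| ≤ 1) (ha : 0 ≤ a) : 1 ≤ signMGF s a := by
    have := signMGF_monotoneOn ((sq_le_one_iff_abs_le_one s).2 hs) (Set.mem_Ici.2 le_rfl)
      (Set.mem_Ici.2 ha) ha
    rwa [signMGF_zero] at this
  rcases le_total 0 a with ha | ha
  · exact key hs ha
  · rw [← signMGF_neg_neg]
    exact key (by rwa [abs_neg]) (by linarith)

theorem signMGF_mul_exp_le_one {s a : ℝ} (hs : |s| ≤ 1) :
    signMGF s a * Real.exp (-a ^ 2) ≤ 1 := by
  have key {s a : ℝ} (hs : |s| ≤ 1) (ha : 0 ≤ a) : signMGF s a * Real.exp (-a ^ 2) ≤ 1 := by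
    have := signMGF_mul_exp_antitoneOn hs (Set.mem_Ici.2 le_rfl) (Set.mem_Ici.2 ha) ha
    simpa [signMGF_zero] using this
  rcases le_total 0 a with ha | ha
  · exact key hs ha
  · rw [← signMGF_neg_neg, ← neg_sq a]
    exact key (by rwa [abs_neg]) (by linarith)

/-- Used when the residual of the pivot changes its inner product with θ from a to b while the
projection of θ loses squared norm Q. Take a ≥ 0 by symmetry. If b ≥ a, monotonicity suffices; if 0
≤ b ≤ a, then a² - b² ≤ 4a(a - b) ≤ Q; if b ≤ 0, the left side is at most 1 and a² ≤ Q. -/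
theorem signMGF_mul_exp_le {s a b Q : ℝ} (hs : |s| ≤ 1) (hQ : 0 ≤ Q)
    (hab : -4 * a * (b - a) ≤ Q) :
    signMGF s b * Real.exp (-b ^ 2) ≤ signMGF s a * Real.exp (-a ^ 2) * Real.exp Q := by
  have key {s a b : ℝ} (hs : |s| ≤ 1) (ha : 0 ≤ a) (hab : -4 * a * (b - a) ≤ Q) :
      signMGF s b * Real.exp (-b ^ 2) ≤ signMGF s a * Real.exp (-a ^ 2) * Real.exp Q := by
    have hg : 0 ≤ signMGF s a := zero_le_one.trans (one_le_signMGF hs)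
    rcases le_total a b with h | h
    · calc signMGF s b * Real.exp (-b ^ 2) ≤ signMGF s a * Real.exp (-a ^ 2) :=
            signMGF_mul_exp_antitoneOn hs (Set.mem_Ici.2 ha) (Set.mem_Ici.2 (ha.trans h)) h
        _ ≤ _ := le_mul_of_one_le_right (by positivity) (Real.one_le_exp hQ)
    · rw [mul_assoc, ← Real.exp_add]
      rcases le_total 0 b with hb | hb
      · refine mul_le_mul ?_ (Real.exp_le_exp.2 ?_) (Real.exp_pos _).le hg
        · exact signMGF_monotoneOn ((sq_le_one_iff_abs_le_one s).2 hs) (Set.mem_Ici.2 hb)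
            (Set.mem_Ici.2 ha) h
        · nlinarith
      · refine (signMGF_mul_exp_le_one hs).trans ?_
        refine one_le_mul_of_one_le_of_one_le (one_le_signMGF hs) (Real.one_le_exp ?_)
        nlinarith [mul_nonneg ha (neg_nonneg.2 hb)]
  rcases le_total 0 a with ha | ha
  · exact key hs ha hab
  · rw [← signMGF_neg_neg s a, ← signMGF_neg_neg s b, ← neg_sq a, ← neg_sq b]
    exact key (by rwa [abs_neg]) (by linarith) (by linarith)

/-- The martingale property of the sign moment generating function under a mean-zero two-point
perturbation of the mean. -/
theorem signMGF_mix (s a x y : ℝ) (hxy : x + y ≠ 0) :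
    y / (x + y) * (Real.exp (a * x) * signMGF (s + x) a) +
      x / (x + y) * (Real.exp (a * -y) * signMGF (s - y) a) = signMGF s a := by
  have e1 : Real.exp (a * x) * signMGF (s + x) a =
      Real.exp (-(a * s)) * (Real.cosh a + (s + x) * Real.sinh a) := by
    rw [signMGF, ← mul_assoc, ← Real.exp_add]; ring_nf
  have e2 : Real.exp (a * -y) * signMGF (s - y) a =
      Real.exp (-(a * s)) * (Real.cosh a + (s - y) * Real.sinh a) := by
    rw [signMGF, ← mul_assoc, ← Real.exp_add]; ring_nf
  rw [e1, e2, signMGF]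
  field_simp
  ring

/-! ### Orthogonal projections and residuals -/

section Geometry

open scoped InnerProductSpace

variable {E : Type*} [NormedAddCommGroup E] [InnerProductSpace ℝ E] [FiniteDimensional ℝ E]

theorem norm_sub_starProjection_sq {S T : Submodule ℝ E} (h : S ≤ T) (x : E) :
    ‖T.starProjection x - S.starProjection x‖ ^ 2 =
      ‖T.starProjection x‖ ^ 2 - ‖S.starProjection x‖ ^ 2 := by
  have h1 : ⟪T.starProjection x - S.starProjection x, S.starProjection x⟫_ℝ = 0 := by
    have e : S.starProjection (T.starProjection x) = S.starProjection x := by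
      have := S.starProjection_comp_starProjection_of_le h
      exact congrArg (fun f => f x) this
    rw [← e]
    exact Submodule.starProjection_inner_eq_zero _ _ (Submodule.starProjection_apply_mem _ _)
  have h2 := norm_add_sq_real (T.starProjection x - S.starProjection x) (S.starProjection x)
  rw [h1, sub_add_cancel] at h2
  linarith

/-- The old residual w and the increment e of the new one are orthogonal, with ‖w‖² + ‖e‖² ≤ 1. In
their plane some z is orthogonal to T', so the loss of projection is at least ⟪x, z⟫² / ‖z‖². The
claim is then (p - q)² ≥ -4pq. -/
theorem residual_inner_bound {S S' T T' : Submodule ℝ E} (hS : S' ≤ S) {v : E} (hv : ‖v‖ ≤ 1)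
    (hT : S ⊔ Submodule.span ℝ {v} = T) (hT' : S' ⊔ Submodule.span ℝ {v} = T') (x : E) :
    -4 * ⟪x, v - S.starProjection v⟫_ℝ *
        (⟪x, v - S'.starProjection v⟫_ℝ - ⟪x, v - S.starProjection v⟫_ℝ) ≤
      ‖T.starProjection x‖ ^ 2 - ‖T'.starProjection x‖ ^ 2 := by
  have hvT : v ∈ T := hT ▸ Submodule.mem_sup_right (Submodule.mem_span_singleton_self v)
  have hST : S ≤ T := hT ▸ le_sup_left
  have hTT : T' ≤ T := by rw [← hT, ← hT']; exact sup_le_sup_right hS _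
  have hQ := norm_sub_starProjection_sq hTT x
  set Q := ‖T.starProjection x‖ ^ 2 - ‖T'.starProjection x‖ ^ 2
  set w := v - S.starProjection v with hw
  set e := S.starProjection v - S'.starProjection v with he
  have heS : e ∈ S := S.sub_mem (Submodule.starProjection_apply_mem _ _)
    (hS (Submodule.starProjection_apply_mem _ _))
  have hwe : ⟪w, e⟫_ℝ = 0 := Submodule.starProjection_inner_eq_zero _ _ heS
  have hw' : v - S'.starProjection v = w + e := by rw [hw, he]; abel
  have hQ0 : 0 ≤ Q := hQ ▸ sq_nonneg _
  rw [hw', inner_add_right, add_sub_cancel_left]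
  have hwv : ⟪w, v⟫_ℝ = ‖w‖ ^ 2 := by
    have h0 : ⟪w, S.starProjection v⟫_ℝ = 0 :=
      Submodule.starProjection_inner_eq_zero _ _ (Submodule.starProjection_apply_mem _ _)
    rw [← real_inner_self_eq_norm_sq, hw, inner_sub_right, ← hw, h0, sub_zero]
  have heS' (y : E) (hy : y ∈ S') : ⟪e, y⟫_ℝ = 0 := by
    have h1 : ⟪w, y⟫_ℝ = 0 := Submodule.starProjection_inner_eq_zero _ _ (hS hy)
    have h2 : ⟪w + e, y⟫_ℝ = 0 := by
      rw [← hw']; exact Submodule.starProjection_inner_eq_zero _ _ hy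
    rw [inner_add_left, h1, zero_add] at h2
    exact h2
  have hev : ⟪e, v⟫_ℝ = ‖e‖ ^ 2 := by
    have hv' : v = w + e + S'.starProjection v := by rw [← hw']; abel
    rw [← real_inner_self_eq_norm_sq]
    conv_lhs => rw [hv']
    rw [inner_add_right, inner_add_right, heS' _ (Submodule.starProjection_apply_mem _ _),
      real_inner_comm, hwe]
    ring
  -- The vector of span{w, e} orthogonal to v: its coefficients balance ⟪w, v⟫ = ‖w‖² against ⟪e, v⟫
  -- = ‖e‖². Orthogonality to S' is automatic.
  set z := ‖e‖ ^ 2 • w - ‖w‖ ^ 2 • e with hz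
  have hzT : z ∈ T := T.sub_mem (T.smul_mem _ (T.sub_mem hvT
    (hST (Submodule.starProjection_apply_mem _ _)))) (T.smul_mem _ (hST heS))
  have hzT' : ∀ y ∈ T', ⟪y, z⟫_ℝ = 0 := by
    intro y hy
    rw [← hT'] at hy
    obtain ⟨y1, hy1, y2, hy2, rfl⟩ := Submodule.mem_sup.1 hy
    obtain ⟨c, rfl⟩ := Submodule.mem_span_singleton.1 hy2
    have h1 : ⟪y1, w⟫_ℝ = 0 := by
      rw [real_inner_comm]; exact Submodule.starProjection_inner_eq_zero _ _ (hS hy1)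
    have h2 : ⟪y1, e⟫_ℝ = 0 := by rw [real_inner_comm]; exact heS' _ hy1
    rw [hz, inner_add_left, inner_sub_right, inner_sub_right, inner_smul_left]
    simp only [inner_smul_right, h1, h2, real_inner_comm _ v, inner_smul_left]
    rw [hwv, hev]
    simp
    ring
  have hxz : ⟪T.starProjection x - T'.starProjection x, z⟫_ℝ = ⟪x, z⟫_ℝ := by
    rw [inner_sub_left, hzT' _ (Submodule.starProjection_apply_mem _ _), sub_zero,
      Submodule.inner_starProjection_left_eq_right, Submodule.starProjection_eq_self_iff.2 hzT]
  have hcs := abs_real_inner_le_norm (T.starProjection x - T'.starProjection x) z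
  rw [hxz] at hcs
  have hcs2 : ⟪x, z⟫_ℝ ^ 2 ≤ Q * ‖z‖ ^ 2 := by
    rw [← hQ, ← mul_pow, ← sq_abs]
    exact pow_le_pow_left₀ (abs_nonneg _) hcs 2
  have hzn : ‖z‖ ^ 2 = ‖w‖ ^ 2 * ‖e‖ ^ 2 * (‖w‖ ^ 2 + ‖e‖ ^ 2) := by
    rw [hz, norm_sub_sq_real, inner_smul_left, inner_smul_right, hwe, norm_smul, norm_smul]
    simp
    ring
  have hle1 : ‖w‖ ^ 2 + ‖e‖ ^ 2 ≤ 1 := by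
    have h1 := norm_add_sq_real w e
    rw [hwe, ← hw'] at h1
    have h2 := norm_sub_starProjection_sq (le_top : S' ≤ ⊤) v
    simp only [Submodule.starProjection_top, ContinuousLinearMap.id_apply] at h2
    nlinarith [sq_nonneg ‖S'.starProjection v‖, norm_nonneg v]
  have hxzv : ⟪x, z⟫_ℝ = ‖e‖ ^ 2 * ⟪x, w⟫_ℝ - ‖w‖ ^ 2 * ⟪x, e⟫_ℝ := by
    rw [hz, inner_sub_right, inner_smul_right, inner_smul_right]
  by_cases hw0 : w = 0
  · rw [hw0]; simpa using hQ0
  by_cases he0 : e = 0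
  · rw [he0]; simpa using hQ0
  have hpos : 0 < ‖w‖ ^ 2 * ‖e‖ ^ 2 :=
    mul_pos (pow_pos (norm_pos_iff.2 hw0) 2) (pow_pos (norm_pos_iff.2 he0) 2)
  have h1 : ⟪x, z⟫_ℝ ^ 2 ≤ Q * (‖w‖ ^ 2 * ‖e‖ ^ 2) := by
    refine hcs2.trans (mul_le_mul_of_nonneg_left ?_ hQ0)
    rw [hzn]
    exact mul_le_of_le_one_right hpos.le hle1
  rw [hxzv] at h1
  refine le_of_mul_le_mul_right ?_ hpos
  nlinarith [sq_nonneg (‖e‖ ^ 2 * ⟪x, w⟫_ℝ + ‖w‖ ^ 2 * ⟪x, e⟫_ℝ)]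

end Geometry

/-! ### Spans of indexed vectors -/

section SpanOf

variable {ι E : Type*} [NormedAddCommGroup E] [InnerProductSpace ℝ E]

/-- The span of the vectors indexed by `A`. -/
def spanOf (v : ι → E) (A : Finset ι) : Submodule ℝ E := Submodule.span ℝ (v '' (A : Set ι))

theorem spanOf_mono (v : ι → E) {A B : Finset ι} (h : A ⊆ B) : spanOf v A ≤ spanOf v B :=
  Submodule.span_mono (Set.image_mono (by exact_mod_cast h))

theorem spanOf_erase_sup [DecidableEq ι] (v : ι → E) {A : Finset ι} {p : ι} (hp : p ∈ A) :
    spanOf v (A.erase p) ⊔ Submodule.span ℝ {v p} = spanOf v A := by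
  rw [spanOf, spanOf, ← Submodule.span_union]
  congr 1
  rw [← Set.image_singleton, ← Set.image_union]
  congr 1
  ext i
  by_cases h : i = p <;> simp [h, hp]

end SpanOf

/-! ### The Gram–Schmidt walk and subgaussian signings -/

section GramSchmidtWalk

open scoped InnerProductSpace

variable {ι : Type*} [Fintype ι]

/-- The coordinates of a fractional coloring that are not yet signs. -/
noncomputable def alive (x : ι → ℝ) : Finset ι :=
  Finset.univ.filter fun i => |x i| < 1

theorem mem_alive {x : ι → ℝ} {i : ι} : i ∈ alive x ↔ |x i| < 1 := by simp [alive]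

theorem exists_step {x u : ι → ℝ} (hx : ∀ i, |x i| ≤ 1) (hu : ∀ i, i ∉ alive x → u i = 0)
    {p : ι} (hp : u p ≠ 0) :
    ∃ δ : ℝ, 0 < δ ∧ (∀ i, |x i + δ * u i| ≤ 1) ∧
      alive (fun i => x i + δ * u i) ⊂ alive x := by
  classical
  -- The time at which coordinate i leaves [-1, 1]: the positive one of the two ratios. The walk
  -- stops at the earliest such time.
  let r : ι → ℝ := fun i => max ((1 - x i) / u i) ((-1 - x i) / u i)
  obtain ⟨j, hj, hmin⟩ := Finset.exists_min_image (Finset.univ.filter fun i => u i ≠ 0) r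
    ⟨p, by simp [hp]⟩
  have hj0 : u j ≠ 0 := by simpa using hj
  have halive (i : ι) (hi : u i ≠ 0) : |x i| < 1 := mem_alive.1 (by_contra fun h => hi (hu i h))
  have hr (i : ι) (hi : u i ≠ 0) : 0 < r i := by
    obtain ⟨h1, h2⟩ := abs_lt.1 (halive i hi)
    rcases lt_or_gt_of_ne hi with h | h
    · exact lt_max_of_lt_right (div_pos_of_neg_of_neg (by linarith) h)
    · exact lt_max_of_lt_left (div_pos (by linarith) h)
  have hstep (i : ι) (hi : u i ≠ 0) (δ : ℝ) (hδ : 0 ≤ δ) (hδr : δ ≤ r i) :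
      |x i + δ * u i| ≤ 1 := by
    obtain ⟨h1, h2⟩ := abs_lt.1 (halive i hi)
    rw [abs_le]
    rcases lt_or_gt_of_ne hi with h | h
    · have : r i = (-1 - x i) / u i := max_eq_right ((div_le_div_right_of_neg h).2 (by linarith))
      rw [this, le_div_iff_of_neg h] at hδr
      constructor <;> nlinarith
    · have : r i = (1 - x i) / u i := max_eq_left ((div_le_div_iff_of_pos_right h).2 (by linarith))
      rw [this, le_div_iff₀ h] at hδr
      constructor <;> nlinarith
  have hall (i : ι) : |x i + r j * u i| ≤ 1 := by
    by_cases hi : u i = 0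
    · simpa [hi] using hx i
    · exact hstep i hi _ (hr j hj0).le (hmin i (by simp [hi]))
  refine ⟨r j, hr j hj0, hall, ?_⟩
  rw [Finset.ssubset_iff_of_subset]
  · refine ⟨j, mem_alive.2 (halive j hj0), ?_⟩
    rw [mem_alive, not_lt]
    rcases max_choice ((1 - x j) / u j) ((-1 - x j) / u j) with h | h
    · have : r j = (1 - x j) / u j := h
      rw [this, div_mul_cancel₀ _ hj0]
      simp
    · have : r j = (-1 - x j) / u j := h
      rw [this, div_mul_cancel₀ _ hj0]
      simp
  · intro i hi
    by_contra h
    have h0 := hu i h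
    rw [mem_alive] at h hi
    simp [h0] at hi
    exact h hi

variable [DecidableEq ι] {E : Type*} [NormedAddCommGroup E] [InnerProductSpace ℝ E]

/-- The fractional coloring `x` of the vectors `v` can be rounded at random to signs `ε` such that
the exponential moments of `∑ (ε i - x i) v i` are bounded by `Φ`. -/
def HasRounding (v : ι → E) (x : ι → ℝ) (Φ : E → ℝ) : Prop :=
  ∃ w : (ι → ℤˣ) → ℝ, (∀ ε, 0 ≤ w ε) ∧ ∑ ε, w ε = 1 ∧
    ∀ θ : E, ∑ ε, w ε * Real.exp ⟪θ, ∑ i, (((ε i : ℤ) : ℝ) - x i) • v i⟫_ℝ ≤ Φ θ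

theorem HasRounding.mono {v : ι → E} {x : ι → ℝ} {Φ Ψ : E → ℝ} (h : HasRounding v x Φ)
    (hΦ : ∀ θ, Φ θ ≤ Ψ θ) : HasRounding v x Ψ := by
  obtain ⟨w, h0, h1, h2⟩ := h
  exact ⟨w, h0, h1, fun θ => (h2 θ).trans (hΦ θ)⟩

theorem HasRounding.mix {v : ι → E} {x u : ι → ℝ} {Φ Ψ : E → ℝ} {a b : ℝ} (ha : 0 < a)
    (hb : 0 < b) (h : HasRounding v (fun i => x i + a * u i) Φ)
    (h' : HasRounding v (fun i => x i + b * -u i) Ψ) :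
    HasRounding v x fun θ =>
      b / (a + b) * (Real.exp (⟪θ, ∑ i, u i • v i⟫_ℝ * a) * Φ θ) +
        a / (a + b) * (Real.exp (⟪θ, ∑ i, u i • v i⟫_ℝ * -b) * Ψ θ) := by
  obtain ⟨w, h0, h1, h2⟩ := h
  obtain ⟨w', h0', h1', h2'⟩ := h'
  refine ⟨fun ε => b / (a + b) * w ε + a / (a + b) * w' ε, fun ε => ?_, ?_, fun θ => ?_⟩
  · have := h0 ε
    have := h0' ε
    positivity
  · rw [Finset.sum_add_distrib, ← Finset.mul_sum, ← Finset.mul_sum, h1, h1']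
    field_simp
    ring
  · have e1 (ε : ι → ℤˣ) : ⟪θ, ∑ i, (((ε i : ℤ) : ℝ) - x i) • v i⟫_ℝ =
        ⟪θ, ∑ i, u i • v i⟫_ℝ * a + ⟪θ, ∑ i, (((ε i : ℤ) : ℝ) - (x i + a * u i)) • v i⟫_ℝ := by
      simp only [inner_sum, inner_smul_right, Finset.sum_mul]
      rw [← Finset.sum_add_distrib]
      exact Finset.sum_congr rfl fun i _ => by ring
    have e2 (ε : ι → ℤˣ) : ⟪θ, ∑ i, (((ε i : ℤ) : ℝ) - x i) • v i⟫_ℝ =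
        ⟪θ, ∑ i, u i • v i⟫_ℝ * -b + ⟪θ, ∑ i, (((ε i : ℤ) : ℝ) - (x i + b * -u i)) • v i⟫_ℝ := by
      simp only [inner_sum, inner_smul_right, Finset.sum_mul]
      rw [← Finset.sum_add_distrib]
      exact Finset.sum_congr rfl fun i _ => by ring
    have hsplit : ∑ ε, (b / (a + b) * w ε + a / (a + b) * w' ε) *
          Real.exp ⟪θ, ∑ i, (((ε i : ℤ) : ℝ) - x i) • v i⟫_ℝ =
        b / (a + b) * (Real.exp (⟪θ, ∑ i, u i • v i⟫_ℝ * a) *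
          ∑ ε, w ε * Real.exp ⟪θ, ∑ i, (((ε i : ℤ) : ℝ) - (x i + a * u i)) • v i⟫_ℝ) +
        a / (a + b) * (Real.exp (⟪θ, ∑ i, u i • v i⟫_ℝ * -b) *
          ∑ ε, w' ε * Real.exp ⟪θ, ∑ i, (((ε i : ℤ) : ℝ) - (x i + b * -u i)) • v i⟫_ℝ) := by
      simp only [Finset.mul_sum]
      rw [← Finset.sum_add_distrib]
      refine Finset.sum_congr rfl fun ε _ => ?_
      rw [add_mul]
      congr 1
      · rw [e1 ε, Real.exp_add]; ring
      · rw [e2 ε, Real.exp_add]; ring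
    refine hsplit.trans_le ?_
    exact add_le_add
      (mul_le_mul_of_nonneg_left (mul_le_mul_of_nonneg_left (h2 θ) (Real.exp_pos _).le)
        (by positivity))
      (mul_le_mul_of_nonneg_left (mul_le_mul_of_nonneg_left (h2' θ) (Real.exp_pos _).le)
        (by positivity))

theorem hasRounding_of_alive_eq_empty (v : ι → E) {x : ι → ℝ} (hx : ∀ i, |x i| ≤ 1)
    (h : alive x = ∅) : HasRounding v x fun _ => 1 := by
  have hε (i : ι) : ∃ ε : ℤˣ, ((ε : ℤ) : ℝ) = x i := by
    have h1 : |x i| = 1 := le_antisymm (hx i) (by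
      by_contra hlt
      have : i ∈ alive x := mem_alive.2 (not_le.1 hlt)
      simp [h] at this)
    rcases eq_or_eq_neg_of_abs_eq h1 with h1 | h1
    · exact ⟨1, by simp [h1]⟩
    · exact ⟨-1, by simp [h1]⟩
  choose ε hε using hε
  refine ⟨fun ε' => if ε' = ε then 1 else 0, fun ε' => by positivity, by simp, fun θ => ?_⟩
  simp [hε]

variable [FiniteDimensional ℝ E]

theorem norm_starProjection_sq_mono {S T : Submodule ℝ E} (h : S ≤ T) (x : E) :
    ‖S.starProjection x‖ ^ 2 ≤ ‖T.starProjection x‖ ^ 2 := by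
  have := norm_sub_starProjection_sq h x
  nlinarith [sq_nonneg ‖T.starProjection x - S.starProjection x‖]

/-- Expanding the projection of the pivot in the other alive vectors gives a move that shifts the
signed sum exactly along the pivot's residual. -/
theorem exists_direction (v : ι → E) (A : Finset ι) {p : ι} (hp : p ∈ A) :
    ∃ u : ι → ℝ, u p = 1 ∧ (∀ i, i ∉ A → u i = 0) ∧
      ∑ i, u i • v i = v p - (spanOf v (A.erase p)).starProjection (v p) := by
  have hmem : (spanOf v (A.erase p)).starProjection (v p) ∈ spanOf v (A.erase p) :=
    Submodule.starProjection_apply_mem _ _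
  obtain ⟨c, hc⟩ := (Submodule.mem_span_image_finset_iff_exists_fun ℝ).1 hmem
  refine ⟨fun i => if i = p then 1 else if h : i ∈ A.erase p then -c ⟨i, h⟩ else 0, by simp,
    fun i hi => ?_, ?_⟩
  · have h1 : i ≠ p := fun h => hi (h ▸ hp)
    simp [h1, hi]
  · rw [← hc, ← Finset.sum_erase_add _ _ (Finset.mem_univ p)]
    have h2 : ∑ i : (A.erase p : Finset ι), c i • v i =
        ∑ i ∈ A.erase p, (if h : i ∈ A.erase p then c ⟨i, h⟩ else 0) • v i := by
      rw [← Finset.sum_coe_sort (A.erase p)]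
      exact Finset.sum_congr rfl fun i _ => by rw [dif_pos i.2]
    rw [h2]
    have h3 : ∑ i ∈ A.erase p, (if h : i ∈ A.erase p then c ⟨i, h⟩ else 0) • v i =
        ∑ i ∈ Finset.univ.erase p, (if h : i ∈ A.erase p then c ⟨i, h⟩ else 0) • v i := by
      refine Finset.sum_subset (Finset.erase_subset_erase _ (Finset.subset_univ _)) ?_
      intro i _ hi
      rw [dif_neg hi, zero_smul]
    rw [h3, sub_eq_add_neg, add_comm, ← Finset.sum_neg_distrib]
    congr 1
    · simp
    · refine Finset.sum_congr rfl fun i hi => ?_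
      beta_reduce
      rw [if_neg (Finset.ne_of_mem_erase hi)]
      split_ifs <;> simp

/-- The bound for the exponential moments of the Gram-Schmidt walk at `x` with pivot `p`. -/
noncomputable def pivotBound (v : ι → E) (x : ι → ℝ) (p : ι) (θ : E) : ℝ :=
  signMGF (x p) ⟪θ, v p - (spanOf v ((alive x).erase p)).starProjection (v p)⟫_ℝ *
    Real.exp (-⟪θ, v p - (spanOf v ((alive x).erase p)).starProjection (v p)⟫_ℝ ^ 2) *
    Real.exp (‖(spanOf v (alive x)).starProjection θ‖ ^ 2)

theorem pivotBound_le (v : ι → E) {x : ι → ℝ} (hx : ∀ i, |x i| ≤ 1) (p : ι)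
    (θ : E) : pivotBound v x p θ ≤ Real.exp (‖(spanOf v (alive x)).starProjection θ‖ ^ 2) :=
  mul_le_of_le_one_left (Real.exp_pos _).le (signMGF_mul_exp_le_one (hx p))

/-- Freezing coordinates lengthens the residual of a surviving pivot, but the loss in ‖Pθ‖², P the
projection onto the alive span, pays for it by `residual_inner_bound` and `signMGF_mul_exp_le`. -/
theorem pivotBound_shrink {v : ι → E} (hv : ∀ i, ‖v i‖ ≤ 1) {x y : ι → ℝ}
    (hy : ∀ i, |y i| ≤ 1) (hA : alive y ⊆ alive x) {p : ι} (hp : p ∈ alive y) (θ : E) :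
    pivotBound v y p θ ≤
      signMGF (y p) ⟪θ, v p - (spanOf v ((alive x).erase p)).starProjection (v p)⟫_ℝ *
        Real.exp (-⟪θ, v p - (spanOf v ((alive x).erase p)).starProjection (v p)⟫_ℝ ^ 2) *
        Real.exp (‖(spanOf v (alive x)).starProjection θ‖ ^ 2) := by
  have hQ := norm_starProjection_sq_mono (spanOf_mono v hA) θ
  have h1 := residual_inner_bound (spanOf_mono v (Finset.erase_subset_erase p hA)) (hv p)
    (spanOf_erase_sup v (hA hp)) (spanOf_erase_sup v hp) θ
  have h2 := signMGF_mul_exp_le (hy p) (sub_nonneg.2 hQ) h1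
  refine (mul_le_mul_of_nonneg_right h2 (Real.exp_pos _).le).trans_eq ?_
  rw [mul_assoc, ← Real.exp_add, sub_add_cancel]

/-- Induction on the number of alive coordinates. A mean-zero two-point step along the pivot
direction freezes a coordinate on either branch, and `signMGF_mix` preserves the pivot factor
exactly. The same pivot is kept while alive; once it freezes, the pivot-free bound is needed, so
both bounds are proved together. -/
theorem hasRounding_aux {v : ι → E} (hv : ∀ i, ‖v i‖ ≤ 1) (n : ℕ) :
    ∀ x : ι → ℝ, (∀ i, |x i| ≤ 1) → (alive x).card = n →
      (∀ p ∈ alive x, HasRounding v x (pivotBound v x p)) ∧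
      HasRounding v x fun θ => Real.exp (‖(spanOf v (alive x)).starProjection θ‖ ^ 2) := by
  induction n using Nat.strong_induction_on with
  | _ n ih =>
  intro x hx hn
  have hpivot : ∀ p ∈ alive x, HasRounding v x (pivotBound v x p) := by
    intro p hp
    obtain ⟨u, hup, hu0, huv⟩ := exists_direction v (alive x) hp
    set α : E → ℝ := fun θ =>
      ⟪θ, v p - (spanOf v ((alive x).erase p)).starProjection (v p)⟫_ℝ with hα
    set R : E → ℝ := fun θ =>
      Real.exp (-α θ ^ 2) * Real.exp (‖(spanOf v (alive x)).starProjection θ‖ ^ 2) with hR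
    have hbranch (y : ι → ℝ) (hy : ∀ i, |y i| ≤ 1) (hA : alive y ⊂ alive x) :
        HasRounding v y fun θ => signMGF (y p) (α θ) * R θ := by
      obtain ⟨h1, h2⟩ := ih _ (hn ▸ Finset.card_lt_card hA) y hy rfl
      by_cases hpy : p ∈ alive y
      · refine (h1 p hpy).mono fun θ => ?_
        rw [hR, ← mul_assoc]
        exact pivotBound_shrink hv hy hA.1 hpy θ
      -- The pivot has frozen. Its residual w has norm at most 1, lies in the old span and is
      -- orthogonal to the new one, so ⟪θ, w⟫² is at most the drop of the squared projection norm,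
      -- and the factor exp(-⟪θ, w⟫²) absorbs it.
      · refine h2.mono fun θ => ?_
        have hyp : |y p| = 1 := le_antisymm (hy p) (not_lt.1 fun h => hpy (mem_alive.2 h))
        have hs : signMGF (y p) (α θ) = 1 := by
          rcases eq_or_eq_neg_of_abs_eq hyp with h | h
          · rw [h, signMGF_one]
          · rw [h, signMGF_neg_one]
        rw [hs, one_mul]
        simp only [hR]
        rw [← Real.exp_add, Real.exp_le_exp]
        have hsub : alive y ⊆ (alive x).erase p := fun i hi =>
          Finset.mem_erase.2 ⟨fun h => hpy (h ▸ hi), hA.1 hi⟩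
        have hle : spanOf v (alive y) ≤ spanOf v (alive x) := spanOf_mono v hA.1
        have hsq := norm_sub_starProjection_sq hle θ
        set w := v p - (spanOf v ((alive x).erase p)).starProjection (v p) with hw
        have hvp : v p ∈ spanOf v (alive x) :=
          Submodule.subset_span ⟨p, by exact_mod_cast hp, rfl⟩
        have hwA : w ∈ spanOf v (alive x) := Submodule.sub_mem _ hvp
          (spanOf_mono v (Finset.erase_subset _ _) (Submodule.starProjection_apply_mem _ _))
        have hw1 : ‖w‖ ≤ 1 := by
          have h3 := norm_sub_starProjection_sq
            (le_top : spanOf v ((alive x).erase p) ≤ ⊤) (v p)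
          simp only [Submodule.starProjection_top, ContinuousLinearMap.id_apply] at h3
          rw [← hw] at h3
          have h4 := hv p
          nlinarith [sq_nonneg ‖(spanOf v ((alive x).erase p)).starProjection (v p)‖,
            norm_nonneg (v p), norm_nonneg w]
        have hinner : α θ = ⟪(spanOf v (alive x)).starProjection θ -
            (spanOf v (alive y)).starProjection θ, w⟫_ℝ := by
          have h5 : ⟪(spanOf v (alive y)).starProjection θ, w⟫_ℝ = 0 := by
            rw [real_inner_comm]
            exact Submodule.starProjection_inner_eq_zero _ _
              (spanOf_mono v hsub (Submodule.starProjection_apply_mem _ _))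
          rw [inner_sub_left, h5, sub_zero, Submodule.inner_starProjection_left_eq_right,
            Submodule.starProjection_eq_self_iff.2 hwA]
        have h6 : |α θ| ≤ ‖(spanOf v (alive x)).starProjection θ -
            (spanOf v (alive y)).starProjection θ‖ := by
          rw [hinner]
          exact (abs_real_inner_le_norm _ _).trans (mul_le_of_le_one_right (norm_nonneg _) hw1)
        have h7 := pow_le_pow_left₀ (abs_nonneg _) h6 2
        rw [sq_abs, hsq] at h7
        linarith
    have hup0 : u p ≠ 0 := by rw [hup]; exact one_ne_zero
    obtain ⟨a, ha, ha1, ha2⟩ := exists_step hx hu0 hup0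
    obtain ⟨b, hb, hb1, hb2⟩ := exists_step (u := fun i => -u i) hx
      (fun i hi => by simp [hu0 i hi]) (neg_ne_zero.2 hup0)
    refine ((hbranch _ ha1 ha2).mix ha hb (hbranch _ hb1 hb2)).mono fun θ => le_of_eq ?_
    have hmix := signMGF_mix (x p) (α θ) a b (by positivity)
    change _ = signMGF (x p) (α θ) * Real.exp (-α θ ^ 2) * Real.exp _
    rw [huv, ← hmix, hup]
    change b / (a + b) * (Real.exp (α θ * a) * _) + a / (a + b) * (Real.exp (α θ * -b) * _) = _
    simp only [hR]
    ring_nf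
  refine ⟨hpivot, ?_⟩
  rcases (alive x).eq_empty_or_nonempty with h | ⟨p, hp⟩
  · exact (hasRounding_of_alive_eq_empty v hx h).mono fun θ => Real.one_le_exp (sq_nonneg _)
  · exact (hpivot p hp).mono fun θ => pivotBound_le v hx p θ

/-- Vectors of norm at most one admit a random signing whose signed sum is subgaussian. -/
theorem exists_subgaussian_signing {v : ι → E} (hv : ∀ i, ‖v i‖ ≤ 1) :
    ∃ w : (ι → ℤˣ) → ℝ, (∀ ε, 0 ≤ w ε) ∧ ∑ ε, w ε = 1 ∧
      ∀ θ : E, ∑ ε, w ε * Real.exp ⟪θ, ∑ i, ((ε i : ℤ) : ℝ) • v i⟫_ℝ ≤ Real.exp (‖θ‖ ^ 2) := by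
  obtain ⟨w, h0, h1, h2⟩ := (hasRounding_aux hv _ 0 (by simp) rfl).2
  refine ⟨w, h0, h1, fun θ => ?_⟩
  have h3 := h2 θ
  simp only [Pi.zero_apply, sub_zero] at h3
  refine h3.trans (Real.exp_le_exp.2 ?_)
  have := norm_starProjection_sq_mono (le_top : spanOf v (alive 0) ≤ ⊤) θ
  simpa only [Submodule.starProjection_top, ContinuousLinearMap.id_apply] using this

/-- Vectors of norm at most `ρ` admit a signing under which finitely many test functionals of norm
at most `τ` are all small. -/
theorem exists_signing_forall_inner_le {v : ι → E} {ρ τ : ℝ} (hρ : 0 < ρ) (hτ : 0 < τ)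
    (hv : ∀ i, ‖v i‖ ≤ ρ) {κ : Type*} [Fintype κ] [Nonempty κ] (θ : κ → E)
    (hθ : ∀ k, ‖θ k‖ ≤ τ) :
    ∃ ε : ι → ℤˣ, ∀ k, |∑ i, ((ε i : ℤ) : ℝ) * ⟪θ k, v i⟫_ℝ| ≤
      2 * ρ * τ * √(Real.log (2 * Fintype.card κ)) := by
  obtain ⟨w, h0, h1, h2⟩ := exists_subgaussian_signing (v := fun i => ρ⁻¹ • v i) fun i => by
    rw [norm_smul, norm_inv, Real.norm_of_nonneg hρ.le, inv_mul_le_iff₀ hρ, mul_one]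
    exact hv i
  have hM : (1 : ℝ) ≤ Fintype.card κ := by exact_mod_cast Fintype.card_pos
  set L := Real.log (2 * Fintype.card κ) with hL
  have hLpos : 0 < L := Real.log_pos (by linarith)
  -- Rescaling the tests to norm at most √L bounds each exponential moment by e^L. The 2·|κ| signed
  -- tests then sum to at most e^(2L), and s·|Y|/(τρ) ≤ 2s² is the claimed bound.
  set s := √L with hs
  have hs0 : 0 < s := Real.sqrt_pos.2 hLpos
  have hss : s ^ 2 = L := Real.sq_sqrt hLpos.le
  have hsum : ∑ ε, w ε * ∑ k, (Real.exp ⟪(s / τ) • θ k, ∑ i, ((ε i : ℤ) : ℝ) • ρ⁻¹ • v i⟫_ℝ +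
      Real.exp ⟪-((s / τ) • θ k), ∑ i, ((ε i : ℤ) : ℝ) • ρ⁻¹ • v i⟫_ℝ) ≤
      ∑ ε, w ε * Real.exp (2 * L) := by
    simp only [Finset.mul_sum, mul_add]
    rw [Finset.sum_comm]
    simp only [Finset.sum_add_distrib]
    rw [← Finset.sum_mul, h1, one_mul]
    have hb (k : κ) : Real.exp (‖(s / τ) • θ k‖ ^ 2) ≤ Real.exp L := by
      rw [Real.exp_le_exp, norm_smul, Real.norm_of_nonneg (by positivity), mul_pow, div_pow, hss]
      have := pow_le_pow_left₀ (norm_nonneg _) (hθ k) 2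
      rw [div_mul_eq_mul_div, div_le_iff₀ (by positivity)]
      gcongr
    have hb' (k : κ) : Real.exp (‖-((s / τ) • θ k)‖ ^ 2) ≤ Real.exp L := by
      rw [norm_neg]; exact hb k
    calc _ ≤ ∑ _k : κ, Real.exp L + ∑ _k : κ, Real.exp L := by
          gcongr with k _ k _
          · exact (h2 _).trans (hb k)
          · exact (h2 _).trans (hb' k)
      _ = (2 * Fintype.card κ) * Real.exp L := by simp; ring
      _ = Real.exp (2 * L) := by
          rw [two_mul L, Real.exp_add, hL, Real.exp_log (by positivity)]
  obtain ⟨ε, hε0, hε⟩ : ∃ ε, 0 < w ε ∧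
      w ε * ∑ k, (Real.exp ⟪(s / τ) • θ k, ∑ i, ((ε i : ℤ) : ℝ) • ρ⁻¹ • v i⟫_ℝ +
        Real.exp ⟪-((s / τ) • θ k), ∑ i, ((ε i : ℤ) : ℝ) • ρ⁻¹ • v i⟫_ℝ) ≤
        w ε * Real.exp (2 * L) := by
    by_contra! hcon
    refine absurd hsum (not_le.2 (Finset.sum_lt_sum (fun ε _ => ?_) ?_))
    · rcases (h0 ε).eq_or_lt with h | h
      · simp [← h]
      · exact (hcon ε h).le
    · obtain ⟨ε, hε⟩ : ∃ ε, 0 < w ε := by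
        by_contra! hcon2
        have : ∑ ε, w ε ≤ 0 := Finset.sum_nonpos fun ε _ => hcon2 ε
        linarith
      exact ⟨ε, Finset.mem_univ _, hcon ε hε⟩
  have hε' := le_of_mul_le_mul_left hε hε0
  refine ⟨ε, fun k => ?_⟩
  have hk := (Finset.single_le_sum (f := fun k =>
    Real.exp ⟪(s / τ) • θ k, ∑ i, ((ε i : ℤ) : ℝ) • ρ⁻¹ • v i⟫_ℝ +
      Real.exp ⟪-((s / τ) • θ k), ∑ i, ((ε i : ℤ) : ℝ) • ρ⁻¹ • v i⟫_ℝ)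
    (fun k _ => by positivity) (Finset.mem_univ k)).trans hε'
  have e : ⟪(s / τ) • θ k, ∑ i, ((ε i : ℤ) : ℝ) • ρ⁻¹ • v i⟫_ℝ =
      s / (τ * ρ) * ∑ i, ((ε i : ℤ) : ℝ) * ⟪θ k, v i⟫_ℝ := by
    simp only [inner_smul_left, inner_sum, inner_smul_right, Finset.mul_sum]
    refine Finset.sum_congr rfl fun i _ => ?_
    simp
    field_simp
  simp only [inner_neg_left, e] at hk
  set Y := ∑ i, ((ε i : ℤ) : ℝ) * ⟪θ k, v i⟫_ℝ
  have hY1 : s / (τ * ρ) * Y ≤ 2 * L :=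
    Real.exp_le_exp.1 ((le_add_of_nonneg_right (Real.exp_pos _).le).trans hk)
  have hY2 : -(s / (τ * ρ) * Y) ≤ 2 * L :=
    Real.exp_le_exp.1 ((le_add_of_nonneg_left (Real.exp_pos _).le).trans hk)
  have hfin : |s / (τ * ρ) * Y| ≤ 2 * L := abs_le.2 ⟨by linarith, hY1⟩
  rw [abs_mul, abs_of_pos (by positivity), div_mul_eq_mul_div, div_le_iff₀ (by positivity),
    ← hss] at hfin
  refine le_of_mul_le_mul_left ?_ hs0
  linarith

end GramSchmidtWalk

/-! ### Discrepancy of box systems as real-valued bounds -/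

section Discrepancy

theorem exists_coloringDisc_eq_disc {α : Type*} (𝓕 : Finset (Finset α)) :
    ∃ x : α → ℤˣ, coloringDisc 𝓕 x = disc 𝓕 :=
  ciInf_mem fun x : α → ℤˣ => coloringDisc 𝓕 x

theorem cast_natAbs_sum_units {α : Type*} (F : Finset α) (x : α → ℤˣ) :
    (((∑ j ∈ F, (x j : ℤ)).natAbs : ℕ) : ℝ) = |∑ j ∈ F, ((x j : ℤ) : ℝ)| := by
  rw [Nat.cast_natAbs, Int.cast_abs, Int.cast_sum]

open Classical in
theorem filter_mem_inducedBoxes {d : ℕ} (P : Finset (Fin d → ℝ)) {a b : Fin d → ℝ}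
    (hab : ∀ i, a i ≤ b i) :
    P.filter (fun p => ∀ i, p i ∈ Set.Icc (a i) (b i)) ∈ inducedBoxes P := by
  rw [inducedBoxes, Finset.mem_filter, Finset.mem_powerset]
  refine ⟨Finset.filter_subset _ _, _, ⟨a, b, hab, rfl⟩, ?_⟩
  ext p
  simp [and_comm]

open Classical in
theorem exists_coloring_abs_sum_le_disc {d : ℕ} (P : Finset (Fin d → ℝ)) :
    ∃ x : (Fin d → ℝ) → ℤˣ, ∀ a b : Fin d → ℝ, (∀ i, a i ≤ b i) →
      |∑ p ∈ P.filter (fun p => ∀ i, p i ∈ Set.Icc (a i) (b i)), ((x p : ℤ) : ℝ)| ≤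
        disc (inducedBoxes P) := by
  obtain ⟨x, hx⟩ := exists_coloringDisc_eq_disc (inducedBoxes P)
  refine ⟨x, fun a b hab => ?_⟩
  rw [← hx, ← cast_natAbs_sum_units, Nat.cast_le]
  exact Finset.le_sup (f := fun F => (∑ j ∈ F, (x j : ℤ)).natAbs) (filter_mem_inducedBoxes P hab)

open Classical in
theorem disc_inducedBoxes_le {d : ℕ} (P : Finset (Fin d → ℝ)) (x : (Fin d → ℝ) → ℤˣ) {D : ℝ}
    (hD : 0 ≤ D) (h : ∀ a b : Fin d → ℝ, (∀ i, a i ≤ b i) →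
      |∑ p ∈ P.filter (fun p => ∀ i, p i ∈ Set.Icc (a i) (b i)), ((x p : ℤ) : ℝ)| ≤ D) :
    (disc (inducedBoxes P) : ℝ) ≤ D := by
  rw [← Nat.le_floor_iff hD]
  refine (ciInf_le (OrderBot.bddBelow _) x).trans (Finset.sup_le fun F hF => ?_)
  rw [Nat.le_floor_iff hD, cast_natAbs_sum_units]
  rw [inducedBoxes, Finset.mem_filter, Finset.mem_powerset] at hF
  obtain ⟨-, R, ⟨a, b, hab, rfl⟩, hFR⟩ := hF
  have hF : F = P.filter fun p => ∀ i, p i ∈ Set.Icc (a i) (b i) := by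
    ext p
    have := Set.ext_iff.1 hFR p
    simpa [and_comm] using this
  rw [hF]
  exact h a b hab

end Discrepancy

/-! ### Dyadic decomposition of prefixes -/

section Dyadic

/-- The incidence vector of the dyadic intervals `[t 2^j, (t+1) 2^j)` containing `r`. -/
def dyadicPoint (K r : ℕ) (c : Fin K × Fin (2 ^ K)) : ℝ :=
  if r / 2 ^ (c.1 : ℕ) = c.2 then 1 else 0

/-- The indicator of the dyadic intervals in the canonical decomposition of `[0, B)`. -/
def dyadicPrefix (K B : ℕ) (c : Fin K × Fin (2 ^ K)) : ℝ :=
  if B / 2 ^ (c.1 : ℕ) % 2 = 1 ∧ (c.2 : ℕ) + 1 = B / 2 ^ (c.1 : ℕ) then 1 else 0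

/-- Comparing r with B digit by digit: the second summand is the comparison of the quotients by 2^K,
still undecided by the lower levels. Passing to the next level splits off the case where the odd
quotient of B exceeds that of r by exactly one. -/
theorem sum_dyadic_digits (K r B : ℕ) :
    ∑ j ∈ Finset.range K, (if B / 2 ^ j % 2 = 1 ∧ r / 2 ^ j + 1 = B / 2 ^ j then (1 : ℝ) else 0) +
      (if r / 2 ^ K < B / 2 ^ K then 1 else 0) = if r < B then 1 else 0 := by
  induction K with
  | zero => simp
  | succ K ih =>
    rw [← ih, Finset.sum_range_succ, pow_succ, ← Nat.div_div_eq_div_mul, ← Nat.div_div_eq_div_mul,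
      add_assoc]
    congr 1
    generalize r / 2 ^ K = r'
    generalize B / 2 ^ K = B'
    by_cases h1 : B' % 2 = 1 ∧ r' + 1 = B'
    · rw [if_pos h1, if_neg (by omega), if_pos (by omega), add_zero]
    · rw [if_neg h1, zero_add]
      exact if_congr (by omega) rfl rfl

theorem sum_ite_div_eq {K r j : ℕ} (hr : r < 2 ^ K) (f : ℕ → ℝ) :
    ∑ t : Fin (2 ^ K), f t * (if r / 2 ^ j = t then (1 : ℝ) else 0) = f (r / 2 ^ j) := by
  have hlt : r / 2 ^ j < 2 ^ K := (Nat.div_le_self _ _).trans_lt hr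
  rw [Finset.sum_eq_single (⟨r / 2 ^ j, hlt⟩ : Fin (2 ^ K))]
  · simp
  · intro t _ ht
    rw [if_neg, mul_zero]
    exact fun h => ht (Fin.ext h.symm)
  · simp

theorem sum_dyadicPrefix_mul_dyadicPoint {K r B : ℕ} (hr : r < 2 ^ K) (hB : B < 2 ^ K) :
    ∑ c, dyadicPrefix K B c * dyadicPoint K r c = if r < B then 1 else 0 := by
  rw [← sum_dyadic_digits K r B, Nat.div_eq_of_lt hr, Nat.div_eq_of_lt hB, Fintype.sum_prod_type,
    if_neg (lt_irrefl 0), add_zero, ← Fin.sum_univ_eq_sum_range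
      (fun j => if B / 2 ^ j % 2 = 1 ∧ r / 2 ^ j + 1 = B / 2 ^ j then (1 : ℝ) else 0) K]
  refine Finset.sum_congr rfl fun j _ => ?_
  exact sum_ite_div_eq (j := j) hr
    fun t => if B / 2 ^ (j : ℕ) % 2 = 1 ∧ t + 1 = B / 2 ^ (j : ℕ) then (1 : ℝ) else 0

theorem sum_dyadicPoint_sq {K r : ℕ} (hr : r < 2 ^ K) : ∑ c, dyadicPoint K r c ^ 2 = K := by
  rw [Fintype.sum_prod_type]
  have h (j : Fin K) : ∑ t, dyadicPoint K r (j, t) ^ 2 = 1 := by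
    rw [← sum_ite_div_eq (j := j) hr fun _ => 1]
    refine Finset.sum_congr rfl fun t _ => ?_
    rw [dyadicPoint, one_mul, ite_pow]
    simp
  simp [h]

theorem sum_dyadicPrefix_le (K B : ℕ) : ∑ c, dyadicPrefix K B c ≤ K := by
  rw [Fintype.sum_prod_type]
  have h (j : Fin K) : ∑ t, dyadicPrefix K B (j, t) ≤ 1 := by
    simp only [dyadicPrefix, Finset.sum_boole]
    have : (Finset.univ.filter fun t : Fin (2 ^ K) =>
        B / 2 ^ (j : ℕ) % 2 = 1 ∧ (t : ℕ) + 1 = B / 2 ^ (j : ℕ)).card ≤ 1 := by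
      rw [Finset.card_le_one]
      intro s hs t ht
      simp only [Finset.mem_filter] at hs ht
      exact Fin.ext (by omega)
    exact_mod_cast this
  calc _ ≤ ∑ _j : Fin K, (1 : ℝ) := Finset.sum_le_sum fun j _ => h j
    _ = K := by simp

theorem sum_dyadicPrefix_sub_sq_le (K A B : ℕ) :
    ∑ c, (dyadicPrefix K B c - dyadicPrefix K A c) ^ 2 ≤ 2 * K := by
  have hA := sum_dyadicPrefix_le K A
  have hB := sum_dyadicPrefix_le K B
  calc _ ≤ ∑ c, (dyadicPrefix K B c + dyadicPrefix K A c) := by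
        refine Finset.sum_le_sum fun c _ => ?_
        simp only [dyadicPrefix]
        split_ifs <;> norm_num
    _ ≤ 2 * K := by rw [Finset.sum_add_distrib]; linarith

theorem sum_prod_apply {ι α : Type*} [Fintype ι] [DecidableEq ι] [Fintype α] (f : ι → α → ℝ) :
    ∑ c : ι → α, ∏ i, f i (c i) = ∏ i, ∑ a, f i a := by
  rw [Finset.prod_univ_sum, Fintype.piFinset_univ]

end Dyadic

/-! ### Upper bound by factorization through dyadic boxes -/

section UpperBound

open Classical in
/-- The number of points of `P` whose `i`-th coordinate is smaller than `a`. -/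
noncomputable def rankBelow {d : ℕ} (P : Finset (Fin d → ℝ)) (i : Fin d) (a : ℝ) : ℕ :=
  (P.filter fun q => q i < a).card

open Classical in
/-- The number of points of `P` whose `i`-th coordinate is at most `a`. -/
noncomputable def rankUpTo {d : ℕ} (P : Finset (Fin d → ℝ)) (i : Fin d) (a : ℝ) : ℕ :=
  (P.filter fun q => q i ≤ a).card

theorem rankBelow_le_iff {d : ℕ} {P : Finset (Fin d → ℝ)} {p : Fin d → ℝ} (hp : p ∈ P)
    (i : Fin d) (a : ℝ) : rankBelow P i a ≤ rankBelow P i (p i) ↔ a ≤ p i := by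
  constructor
  · intro h
    by_contra! hlt
    refine absurd h (not_le.2 (Finset.card_lt_card ?_))
    rw [Finset.ssubset_iff_of_subset]
    · exact ⟨p, by simp [hp, hlt], by simp⟩
    · intro q hq
      simp only [Finset.mem_filter] at hq ⊢
      exact ⟨hq.1, hq.2.trans hlt⟩
  · intro h
    refine Finset.card_le_card fun q hq => ?_
    simp only [Finset.mem_filter] at hq ⊢
    exact ⟨hq.1, hq.2.trans_le h⟩

/-- Together with `rankBelow_le_iff`, this turns a closed interval of coordinates into a half-open
interval of ranks; points with equal coordinates share a rank. -/
theorem rankBelow_lt_iff {d : ℕ} {P : Finset (Fin d → ℝ)} {p : Fin d → ℝ} (hp : p ∈ P)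
    (i : Fin d) (b : ℝ) : rankBelow P i (p i) < rankUpTo P i b ↔ p i ≤ b := by
  constructor
  · intro h
    by_contra! hlt
    refine absurd h (not_lt.2 (Finset.card_le_card fun q hq => ?_))
    simp only [Finset.mem_filter] at hq ⊢
    exact ⟨hq.1, hq.2.trans_lt hlt⟩
  · intro h
    refine Finset.card_lt_card ?_
    rw [Finset.ssubset_iff_of_subset]
    · exact ⟨p, by simp [hp, h], by simp⟩
    · intro q hq
      simp only [Finset.mem_filter] at hq ⊢
      exact ⟨hq.1, hq.2.le.trans h⟩

theorem rankBelow_le_card {d : ℕ} (P : Finset (Fin d → ℝ)) (i : Fin d) (a : ℝ) :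
    rankBelow P i a ≤ P.card := Finset.card_filter_le _ _

theorem rankUpTo_le_card {d : ℕ} (P : Finset (Fin d → ℝ)) (i : Fin d) (a : ℝ) :
    rankUpTo P i a ≤ P.card := Finset.card_filter_le _ _

theorem rankBelow_le_rankUpTo {d : ℕ} (P : Finset (Fin d → ℝ)) (i : Fin d) {a b : ℝ}
    (h : a ≤ b) : rankBelow P i a ≤ rankUpTo P i b := by
  refine Finset.card_le_card fun q hq => ?_
  simp only [Finset.mem_filter] at hq ⊢
  exact ⟨hq.1, hq.2.le.trans h⟩

theorem disc_inducedBoxes_le_of_card_lt_two_pow {d : ℕ} (P : Finset (Fin d → ℝ)) {K : ℕ}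
    (hK0 : 0 < K) (hK : P.card < 2 ^ K) :
    (disc (inducedBoxes P) : ℝ) ≤
      2 * (2 * K) ^ d * √(Real.log (2 * ((P.card + 1) ^ d * (P.card + 1) ^ d))) := by
  classical
  set n := P.card with hn
  set ρ : ℝ := √((2 * K) ^ d) with hρdef
  have hKpos : (0 : ℝ) < K := by exact_mod_cast hK0
  have hρ : 0 < ρ := Real.sqrt_pos.2 (by positivity)
  have hρρ : ρ * ρ = (2 * K) ^ d := Real.mul_self_sqrt (by positivity)
  -- The factorization of the incidence matrix: v for points, θ for boxes given by pairs of rank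
  -- vectors. The bound ρ is what θ needs; for v it has a factor 2^(d/2) to spare.
  let v : P → EuclideanSpace ℝ (Fin d → Fin K × Fin (2 ^ K)) := fun p =>
    WithLp.toLp 2 fun c => ∏ i, dyadicPoint K (rankBelow P i (p.1 i)) (c i)
  let θ : (Fin d → Fin (n + 1)) × (Fin d → Fin (n + 1)) →
      EuclideanSpace ℝ (Fin d → Fin K × Fin (2 ^ K)) := fun k =>
    WithLp.toLp 2 fun c => ∏ i, (dyadicPrefix K (k.2 i) (c i) - dyadicPrefix K (k.1 i) (c i))
  have hrank (i : Fin d) (a : ℝ) : rankBelow P i a < 2 ^ K := (rankBelow_le_card P i a).trans_lt hK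
  have hv (p : P) : ‖v p‖ ≤ ρ := by
    refine Real.le_sqrt_of_sq_le ?_
    rw [EuclideanSpace.norm_sq_eq]
    simp only [v, Real.norm_eq_abs, sq_abs, ← Finset.prod_pow]
    rw [sum_prod_apply fun i a => dyadicPoint K (rankBelow P i (p.1 i)) a ^ 2]
    simp only [sum_dyadicPoint_sq (hrank _ _), Finset.prod_const, Finset.card_univ,
      Fintype.card_fin]
    gcongr
    linarith
  have hθ (k) : ‖θ k‖ ≤ ρ := by
    refine Real.le_sqrt_of_sq_le ?_
    rw [EuclideanSpace.norm_sq_eq]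
    simp only [θ, Real.norm_eq_abs, sq_abs, ← Finset.prod_pow]
    rw [sum_prod_apply fun i a => (dyadicPrefix K (k.2 i) a - dyadicPrefix K (k.1 i) a) ^ 2]
    calc _ ≤ ∏ _i : Fin d, (2 * K : ℝ) := Finset.prod_le_prod
          (fun i _ => Finset.sum_nonneg fun _ _ => sq_nonneg _)
          fun i _ => sum_dyadicPrefix_sub_sq_le K _ _
      _ = (2 * K) ^ d := by simp
  obtain ⟨ε, hε⟩ := exists_signing_forall_inner_le hρ hρ hv θ hθ
  refine disc_inducedBoxes_le P (fun p => if h : p ∈ P then ε ⟨p, h⟩ else 1) (by positivity) ?_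
  intro a b hab
  have hk := hε (fun i => ⟨rankBelow P i (a i), Nat.lt_succ_of_le (rankBelow_le_card P i _)⟩,
    fun i => ⟨rankUpTo P i (b i), Nat.lt_succ_of_le (rankUpTo_le_card P i _)⟩)
  have hinner (p : P) : inner ℝ (θ (fun i => ⟨rankBelow P i (a i),
        Nat.lt_succ_of_le (rankBelow_le_card P i _)⟩,
        fun i => ⟨rankUpTo P i (b i), Nat.lt_succ_of_le (rankUpTo_le_card P i _)⟩)) (v p) =
      if ∀ i, p.1 i ∈ Set.Icc (a i) (b i) then 1 else 0 := by
    rw [PiLp.inner_apply]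
    simp only [v, θ, RCLike.inner_apply, conj_trivial, ← Finset.prod_mul_distrib]
    rw [sum_prod_apply fun i c => dyadicPoint K (rankBelow P i (p.1 i)) c *
      (dyadicPrefix K (rankUpTo P i (b i)) c - dyadicPrefix K (rankBelow P i (a i)) c)]
    have hterm (i : Fin d) : ∑ c, dyadicPoint K (rankBelow P i (p.1 i)) c *
        (dyadicPrefix K (rankUpTo P i (b i)) c - dyadicPrefix K (rankBelow P i (a i)) c) =
        if p.1 i ∈ Set.Icc (a i) (b i) then 1 else 0 := by
      have h1 := rankBelow_le_iff p.2 i (a i)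
      have h2 := rankBelow_lt_iff p.2 i (b i)
      have h3 := rankBelow_le_rankUpTo P i (hab i)
      simp only [mul_comm (dyadicPoint _ _ _), sub_mul, Finset.sum_sub_distrib]
      rw [sum_dyadicPrefix_mul_dyadicPoint (hrank _ _) ((rankUpTo_le_card P i _).trans_lt hK),
        sum_dyadicPrefix_mul_dyadicPoint (hrank _ _) (hrank _ _)]
      simp only [Set.mem_Icc, ← h1, ← h2]
      split_ifs <;> first | omega | norm_num
    simp only [hterm]
    rw [Finset.prod_boole]
    simp
  simp only [hinner] at hk
  have hsum : ∑ p ∈ P.filter (fun p => ∀ i, p i ∈ Set.Icc (a i) (b i)),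
      (((if h : p ∈ P then ε ⟨p, h⟩ else 1 : ℤˣ) : ℤ) : ℝ) =
      ∑ p : P, ((ε p : ℤ) : ℝ) * if ∀ i, p.1 i ∈ Set.Icc (a i) (b i) then 1 else 0 := by
    rw [Finset.sum_filter, ← Finset.sum_coe_sort P]
    refine Finset.sum_congr rfl fun p _ => ?_
    rw [dif_pos p.2, mul_ite, mul_one, mul_zero]
  rw [hsum]
  refine hk.trans_eq ?_
  rw [mul_assoc 2 ρ ρ, hρρ]
  simp

theorem exists_disc_inducedBoxes_upper_bound (d : ℕ) :
    ∃ C : ℝ, 0 < C ∧ ∀ n : ℕ, 2 ≤ n → ∀ P : Finset (Fin d → ℝ), P.card = n →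
      (disc (inducedBoxes P) : ℝ) ≤ C * Real.log n ^ ((d : ℝ) + 1 / 2) := by
  -- Here K = ⌊log₂ n⌋ + 1 ≤ 3 log n gives (2K)^d ≤ 6^d (log n)^d, and n + 1 ≤ n² bounds the
  -- logarithm under the root by (4d + 1) log n.
  refine ⟨2 * 6 ^ d * √(4 * d + 1), by positivity, ?_⟩
  intro n hn P hP
  have hn2 : (2 : ℝ) ≤ n := by exact_mod_cast hn
  have hn0 : (0 : ℝ) < n := by linarith
  set l := Real.log n with hl
  have hlog2 : Real.log 2 ≤ l := Real.log_le_log (by norm_num) hn2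
  have hl2 := Real.log_two_gt_d9
  have hl0 : 0 < l := by linarith
  have hK : ((Nat.log 2 n + 1 : ℕ) : ℝ) ≤ 3 * l := by
    have h1 : ((2 : ℕ) : ℝ) ^ Nat.log 2 n ≤ n := by
      exact_mod_cast Nat.pow_log_le_self 2 (by omega)
    have h2 := Real.log_le_log (by positivity) h1
    rw [Real.log_pow] at h2
    push_cast at h2 ⊢
    have h3 : (0 : ℝ) ≤ Nat.log 2 n := Nat.cast_nonneg _
    nlinarith
  have hb := disc_inducedBoxes_le_of_card_lt_two_pow P (K := Nat.log 2 n + 1) (by omega)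
    (hP ▸ Nat.lt_pow_succ_log_self one_lt_two n)
  rw [hP] at hb
  have hL : Real.log (2 * ((n + 1 : ℝ) ^ d * (n + 1 : ℝ) ^ d)) ≤ (4 * d + 1) * l := by
    rw [Real.log_mul (by norm_num) (by positivity), Real.log_mul (by positivity) (by positivity),
      Real.log_pow]
    have h1 : Real.log (n + 1 : ℝ) ≤ 2 * l := by
      have := Real.log_le_log (by linarith : (0 : ℝ) < n + 1)
        (by nlinarith : (n + 1 : ℝ) ≤ (n : ℝ) ^ 2)
      rwa [Real.log_pow] at this
    have h2 : (0 : ℝ) ≤ d := Nat.cast_nonneg d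
    nlinarith
  calc (disc (inducedBoxes P) : ℝ) ≤ _ := hb
    _ ≤ 2 * (2 * (3 * l)) ^ d * √((4 * d + 1) * l) := by
        gcongr
    _ = 2 * 6 ^ d * √(4 * d + 1) * l ^ ((d : ℝ) + 1 / 2) := by
        rw [Real.rpow_add hl0, Real.rpow_natCast, ← Real.sqrt_eq_rpow,
          Real.sqrt_mul (by positivity),
          ← mul_assoc 2 3 l, mul_pow]
        norm_num
        ring

end UpperBound

/-! ### Determinant lower bound for hereditary discrepancy -/

section DeterminantBound

open MeasureTheory Filter Topology

variable {κ : Type*} [Fintype κ] [DecidableEq κ]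

/-- Binary digits are removed from the last one up: a signing of the coordinates with odd numerator
decides which are rounded up and which down. Removing the last of m digits costs D/2^m, and the
costs form a geometric series. -/
theorem exists_rounding_of_dyadic (B : Matrix κ κ ℝ) {D : ℝ}
    (h : ∀ J : Finset κ, ∃ ε : κ → ℤˣ, ∀ i, |∑ j ∈ J, B i j * ((ε j : ℤ) : ℝ)| ≤ D) (m : ℕ) :
    ∀ x : κ → ℕ, (∀ j, x j ≤ 2 ^ m) → ∃ z : Finset κ, ∀ i,
      |∑ j, B i j * ((x j : ℝ) / 2 ^ m - if j ∈ z then 1 else 0)| ≤ D * (1 - 1 / 2 ^ m) := by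
  induction m with
  | zero =>
    intro x hx
    refine ⟨Finset.univ.filter fun j => x j = 1, fun i => ?_⟩
    have h0 (j : κ) : (x j : ℝ) / 2 ^ 0 -
        (if j ∈ Finset.univ.filter (fun j => x j = 1) then (1 : ℝ) else 0) = 0 := by
      have := hx j
      have : x j = 0 ∨ x j = 1 := by omega
      rcases this with h | h <;> simp [h]
    simp only [h0]
    simp
  | succ m ih =>
    intro x hx
    obtain ⟨ε, hε⟩ := h (Finset.univ.filter fun j => x j % 2 = 1)
    obtain ⟨z, hz⟩ := ih
      (fun j => if x j % 2 = 1 ∧ ε j = 1 then (x j + 1) / 2 else x j / 2) (fun j => by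
        have := hx j
        rw [pow_succ] at this
        split_ifs <;> omega)
    refine ⟨z, fun i => ?_⟩
    have hstep (j : κ) : (x j : ℝ) / 2 ^ (m + 1) =
        ((if x j % 2 = 1 ∧ ε j = 1 then (x j + 1) / 2 else x j / 2 : ℕ) : ℝ) / 2 ^ m -
          (if x j % 2 = 1 then ((ε j : ℤ) : ℝ) else 0) / 2 ^ (m + 1) := by
      have hkey : (x j : ℝ) =
          2 * ((if x j % 2 = 1 ∧ ε j = 1 then (x j + 1) / 2 else x j / 2 : ℕ) : ℝ) -
          (if x j % 2 = 1 then ((ε j : ℤ) : ℝ) else 0) := by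
        rcases Int.units_eq_one_or (ε j) with he | he
        · by_cases hodd : x j % 2 = 1
          · have h1 : x j + 1 = 2 * ((x j + 1) / 2) := by omega
            have h2 : (x j : ℝ) + 1 = 2 * (((x j + 1) / 2 : ℕ) : ℝ) := by exact_mod_cast h1
            simp only [he, hodd, and_self, if_true]
            push_cast at h2 ⊢
            linarith
          · have h1 : x j = 2 * (x j / 2) := by omega
            have h2 : (x j : ℝ) = 2 * ((x j / 2 : ℕ) : ℝ) := by exact_mod_cast h1
            simp only [hodd, false_and, if_false]
            linarith
        · have hne : (-1 : ℤˣ) ≠ 1 := by decide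
          by_cases hodd : x j % 2 = 1
          · have h1 : x j = 2 * (x j / 2) + 1 := by omega
            have h2 : (x j : ℝ) = 2 * ((x j / 2 : ℕ) : ℝ) + 1 := by exact_mod_cast h1
            simp only [he, hodd, hne, and_false, if_false, if_true]
            push_cast at h2 ⊢
            linarith
          · have h1 : x j = 2 * (x j / 2) := by omega
            have h2 : (x j : ℝ) = 2 * ((x j / 2 : ℕ) : ℝ) := by exact_mod_cast h1
            simp only [hodd, false_and, if_false]
            linarith
      rw [pow_succ]
      field_simp
      linarith
    have hsplit : ∑ j, B i j * ((x j : ℝ) / 2 ^ (m + 1) - if j ∈ z then 1 else 0) =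
        ∑ j, B i j * (((if x j % 2 = 1 ∧ ε j = 1 then (x j + 1) / 2 else x j / 2 : ℕ) : ℝ) / 2 ^ m -
          if j ∈ z then 1 else 0) -
        (∑ j ∈ Finset.univ.filter (fun j => x j % 2 = 1), B i j * ((ε j : ℤ) : ℝ)) /
          2 ^ (m + 1) := by
      rw [Finset.sum_filter, Finset.sum_div, ← Finset.sum_sub_distrib]
      refine Finset.sum_congr rfl fun j _ => ?_
      rw [hstep j]
      split_ifs <;> ring
    rw [hsplit]
    refine (abs_sub _ _).trans ?_
    rw [abs_div, abs_of_pos (by positivity : (0 : ℝ) < 2 ^ (m + 1))]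
    have h1 := hz i
    have h2 : |∑ j ∈ Finset.univ.filter (fun j => x j % 2 = 1), B i j * ((ε j : ℤ) : ℝ)| /
        2 ^ (m + 1) ≤ D / 2 ^ (m + 1) := by
      have := hε i
      gcongr
    have h3 : D * (1 - 1 / 2 ^ (m + 1)) = D * (1 - 1 / 2 ^ m) + D / 2 ^ (m + 1) := by
      rw [pow_succ]
      field_simp
      ring
    rw [h3]
    exact add_le_add h1 h2

/-- The points that can be rounded form a finite union of closed sets, and dyadic points approximate
every point of the cube. -/
theorem exists_rounding_of_mem_Icc (B : Matrix κ κ ℝ) {D : ℝ} (hD : 0 ≤ D)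
    (h : ∀ J : Finset κ, ∃ ε : κ → ℤˣ, ∀ i, |∑ j ∈ J, B i j * ((ε j : ℤ) : ℝ)| ≤ D)
    {x : κ → ℝ} (hx : ∀ j, x j ∈ Set.Icc (0 : ℝ) 1) :
    ∃ z : Finset κ, ∀ i, |∑ j, B i j * (x j - if j ∈ z then 1 else 0)| ≤ D := by
  have hclosed : IsClosed (⋃ z : Finset κ,
      {x : κ → ℝ | ∀ i, |∑ j, B i j * (x j - if j ∈ z then 1 else 0)| ≤ D}) := by
    refine isClosed_iUnion_of_finite fun z => ?_
    simp only [Set.ofPred_forall]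
    exact isClosed_iInter fun i => isClosed_le (by fun_prop) continuous_const
  have hlim : Tendsto (fun m : ℕ => fun j => (⌊x j * (2 : ℝ) ^ m⌋₊ : ℝ) / 2 ^ m) atTop (𝓝 x) := by
    refine tendsto_pi_nhds.2 fun j => ?_
    exact (tendsto_nat_floor_mul_div_atTop (hx j).1).comp
      (tendsto_pow_atTop_atTop_of_one_lt (one_lt_two : (1 : ℝ) < 2))
  have hmem := hclosed.mem_of_tendsto hlim (Eventually.of_forall fun m => by
    obtain ⟨z, hz⟩ := exists_rounding_of_dyadic B h m (fun j => ⌊x j * (2 : ℝ) ^ m⌋₊) (fun j => by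
      have h1 : x j * (2 : ℝ) ^ m ≤ ((2 ^ m : ℕ) : ℝ) := by
        push_cast
        exact mul_le_of_le_one_left (by positivity) (hx j).2
      exact Nat.floor_le_of_le h1)
    refine Set.mem_iUnion.2 ⟨z, fun i => (hz i).trans ?_⟩
    exact mul_le_of_le_one_right hD (by simp))
  obtain ⟨z, hz⟩ := Set.mem_iUnion.1 hmem
  exact ⟨z, hz⟩

/-- The determinant lower bound for hereditary discrepancy. -/
theorem abs_det_le_of_forall_signing (B : Matrix κ κ ℝ) {D : ℝ} (hD : 0 ≤ D)
    (h : ∀ J : Finset κ, ∃ ε : κ → ℤˣ, ∀ i, |∑ j ∈ J, B i j * ((ε j : ℤ) : ℝ)| ≤ D) :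
    |B.det| ≤ (4 * D) ^ Fintype.card κ := by
  by_cases hdet : B.det = 0
  · rw [hdet, abs_zero]; positivity
  have hdet' : LinearMap.det (Matrix.toLin' B) ≠ 0 := by rwa [LinearMap.det_toLin']
  let c (z : Finset κ) : κ → ℝ := fun i => ∑ j, B i j * if j ∈ z then 1 else 0
  -- Rounding covers the unit cube by 2^k preimages of cubes of side 2D, each of volume (2D)^k /
  -- |det B|; comparing volumes gives the bound.
  have hcover : Set.Icc (0 : κ → ℝ) 1 ⊆ ⋃ z : Finset κ,
      Matrix.toLin' B ⁻¹' Set.Icc (fun i => c z i - D) (fun i => c z i + D) := by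
    intro x hx
    obtain ⟨z, hz⟩ := exists_rounding_of_mem_Icc B hD h (x := x) fun j => ⟨hx.1 j, hx.2 j⟩
    have hb (i : κ) := abs_le.1 (hz i)
    simp only [mul_sub, Finset.sum_sub_distrib] at hb
    refine Set.mem_iUnion.2 ⟨z, fun i => ?_, fun i => ?_⟩
    · change c z i - D ≤ ∑ j, B i j * x j
      linarith [(hb i).1]
    · change ∑ j, B i j * x j ≤ c z i + D
      linarith [(hb i).2]
  have hvol (z : Finset κ) :
      volume (Matrix.toLin' B ⁻¹' Set.Icc (fun i => c z i - D) (fun i => c z i + D)) =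
        ENNReal.ofReal (|B.det|⁻¹ * (2 * D) ^ Fintype.card κ) := by
    rw [Measure.addHaar_preimage_linearMap _ hdet', LinearMap.det_toLin', Real.volume_Icc_pi,
      abs_inv, ENNReal.ofReal_mul (by positivity), ENNReal.ofReal_pow (by positivity)]
    have h2 (i : κ) : c z i + D - (c z i - D) = 2 * D := by ring
    simp [h2]
  have hle := (measure_mono (μ := volume) hcover).trans (measure_iUnion_le _)
  simp only [hvol] at hle
  rw [Real.volume_Icc_pi, tsum_fintype] at hle
  simp only [Pi.one_apply, Pi.zero_apply, sub_zero, ENNReal.ofReal_one, Finset.prod_const_one,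
    Finset.sum_const, Finset.card_univ, Fintype.card_finset, nsmul_eq_mul] at hle
  rw [← ENNReal.ofReal_natCast, ← ENNReal.ofReal_mul (by positivity),
    ← ENNReal.ofReal_one, ENNReal.ofReal_le_ofReal_iff (by positivity)] at hle
  have hpos : 0 < |B.det| := abs_pos.2 hdet
  push_cast at hle
  have h4 : (4 * D) ^ Fintype.card κ = 2 ^ Fintype.card κ * (2 * D) ^ Fintype.card κ := by
    rw [← mul_pow]; ring
  rw [h4]
  calc |B.det| = |B.det| * 1 := (mul_one _).symm
    _ ≤ |B.det| * (2 ^ Fintype.card κ * (|B.det|⁻¹ * (2 * D) ^ Fintype.card κ)) := by gcongr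
    _ = _ := by field_simp

end DeterminantBound

/-! ### Cauchy–Binet and compression by orthogonal frames -/

section CauchyBinet

variable {κ ν : Type*} [Fintype κ] [DecidableEq κ] [Fintype ν]

theorem det_mul_eq_sum_prod_mul_det (M : Matrix κ ν ℝ) (N : Matrix ν κ ℝ) :
    (M * N).det = ∑ f : κ → ν, (∏ i, M i (f i)) * (N.submatrix f id).det := by
  have hrow : M * N = fun i => ∑ a, M i a • N a := by
    ext i j
    simp [Matrix.mul_apply]
  have h := (Matrix.detRowAlternating (n := κ) (R := ℝ)).toMultilinearMap.map_sum
    (fun i a => M i a • N a)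
  change (M * N).det = _
  rw [hrow]
  refine h.trans (Finset.sum_congr rfl fun f _ => ?_)
  exact (Matrix.detRowAlternating (n := κ) (R := ℝ)).toMultilinearMap.map_smul_univ
    (fun i => M i (f i)) (fun i => N (f i))

/-- The Cauchy-Binet formula, summed over all functions instead of all subsets. -/
theorem factorial_mul_det_mul (M : Matrix κ ν ℝ) (N : Matrix ν κ ℝ) :
    ((Fintype.card κ).factorial : ℝ) * (M * N).det =
      ∑ f : κ → ν, (M.submatrix id f).det * (N.submatrix f id).det := by
  -- Reindexing f by σ permutes the rows of the second minor, and the two signs cancel. Each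
  -- permutation thus contributes one full copy of the determinant, hence the factorial.
  have hσ (σ : Equiv.Perm κ) : ∑ f : κ → ν, ((Equiv.Perm.sign σ : ℤ) : ℝ) *
      (∏ i, M (σ i) (f i)) * (N.submatrix f id).det = (M * N).det := by
    rw [det_mul_eq_sum_prod_mul_det, ← (Equiv.arrowCongr σ (Equiv.refl ν)).symm.sum_comp]
    refine Finset.sum_congr rfl fun f _ => ?_
    have h1 : (N.submatrix ((Equiv.arrowCongr σ (Equiv.refl ν)).symm f) id).det =
        ((Equiv.Perm.sign σ : ℤ) : ℝ) * (N.submatrix f id).det :=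
      Matrix.det_permute σ (N.submatrix f id)
    have h2 : ∏ i, M (σ i) ((Equiv.arrowCongr σ (Equiv.refl ν)).symm f i) = ∏ i, M i (f i) :=
      Equiv.prod_comp σ fun i => M i (f i)
    have h3 : ((Equiv.Perm.sign σ : ℤ) : ℝ) * ((Equiv.Perm.sign σ : ℤ) : ℝ) = 1 := by
      rcases Int.units_eq_one_or (Equiv.Perm.sign σ) with h | h <;> simp [h]
    rw [h1, h2]
    linear_combination ((∏ i, M i (f i)) * (N.submatrix f id).det) * h3
  have hexp (f : κ → ν) : (M.submatrix id f).det * (N.submatrix f id).det =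
      ∑ σ : Equiv.Perm κ, ((Equiv.Perm.sign σ : ℤ) : ℝ) * (∏ i, M (σ i) (f i)) *
        (N.submatrix f id).det := by
    rw [Matrix.det_apply', Finset.sum_mul]
    rfl
  simp only [hexp]
  rw [Finset.sum_comm]
  simp only [hσ]
  rw [Finset.sum_const, Finset.card_univ, Fintype.card_perm, nsmul_eq_mul]

/-- Cauchy–Schwarz over all functions; Cauchy–Binet for VᵀV evaluates the sum of squared minors. -/
theorem sum_abs_det_submatrix_sq_le {V : Matrix ν κ ℝ} {β : ℝ}
    (hV : V.transpose * V = Matrix.scalar κ β) :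
    (∑ f : κ → ν, |(V.submatrix f id).det|) ^ 2 ≤
      (Fintype.card ν : ℝ) ^ Fintype.card κ *
        ((Fintype.card κ).factorial * β ^ Fintype.card κ) := by
  have h := factorial_mul_det_mul V.transpose V
  rw [hV, Matrix.scalar_apply, Matrix.det_diagonal, Finset.prod_const, Finset.card_univ] at h
  have hsq (f : κ → ν) : (V.transpose.submatrix id f).det * (V.submatrix f id).det =
      |(V.submatrix f id).det| ^ 2 := by
    rw [← Matrix.transpose_submatrix, Matrix.det_transpose, sq_abs, sq]
  simp only [hsq] at h
  rw [h]
  have := sq_sum_le_card_mul_sum_sq (s := (Finset.univ : Finset (κ → ν)))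
    (f := fun f => |(V.submatrix f id).det|)
  simpa using this

/-- Cauchy–Binet is applied on both sides of A, giving two factorials; the product of the two sums
of frame minors gives one back. -/
theorem factorial_mul_abs_det_le {A : Matrix ν ν ℝ} {U V : Matrix ν κ ℝ} {β M : ℝ}
    (hV : V.transpose * V = Matrix.scalar κ β)
    (hU : U.transpose * U = Matrix.scalar κ β)
    (hA : ∀ f g : κ → ν, |(A.submatrix f g).det| ≤ M) (hM : 0 ≤ M) :
    ((Fintype.card κ).factorial : ℝ) * |(V.transpose * (A * U)).det| ≤
      M * (Fintype.card ν * β) ^ Fintype.card κ := by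
  set F : ℝ := ((Fintype.card κ).factorial : ℝ) with hF
  have hFpos : 0 < F := by rw [hF]; exact_mod_cast Nat.factorial_pos _
  set SV := ∑ f : κ → ν, |(V.submatrix f id).det| with hSV
  set SU := ∑ f : κ → ν, |(U.submatrix f id).det| with hSU
  have hV2 := sum_abs_det_submatrix_sq_le hV
  have hU2 := sum_abs_det_submatrix_sq_le hU
  have hinner (f : κ → ν) : F * |((A * U).submatrix f id).det| ≤ M * SU := by
    have h := factorial_mul_det_mul (A.submatrix f id) U
    have e : A.submatrix f id * U = (A * U).submatrix f id := by
      ext i j; simp [Matrix.mul_apply]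
    rw [e] at h
    rw [← abs_of_pos hFpos, ← abs_mul, hF, h, hSU, Finset.mul_sum]
    refine (Finset.abs_sum_le_sum_abs _ _).trans (Finset.sum_le_sum fun g _ => ?_)
    rw [abs_mul, Matrix.submatrix_submatrix]
    exact mul_le_mul_of_nonneg_right (hA _ _) (abs_nonneg _)
  have houter : F * (F * |(V.transpose * (A * U)).det|) ≤ M * (SV * SU) := by
    have h := factorial_mul_det_mul V.transpose (A * U)
    have h1 : F * |(V.transpose * (A * U)).det| ≤
        ∑ f : κ → ν, |(V.submatrix f id).det| * |((A * U).submatrix f id).det| := by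
      rw [← abs_of_pos hFpos, ← abs_mul, hF, h]
      refine (Finset.abs_sum_le_sum_abs _ _).trans_eq (Finset.sum_congr rfl fun f _ => ?_)
      rw [abs_mul, ← Matrix.transpose_submatrix, Matrix.det_transpose]
    calc F * (F * |(V.transpose * (A * U)).det|)
        ≤ F * ∑ f : κ → ν, |(V.submatrix f id).det| * |((A * U).submatrix f id).det| := by
          gcongr
      _ = ∑ f : κ → ν, |(V.submatrix f id).det| * (F * |((A * U).submatrix f id).det|) := by
          rw [Finset.mul_sum]
          exact Finset.sum_congr rfl fun f _ => by ring
      _ ≤ ∑ f : κ → ν, |(V.submatrix f id).det| * (M * SU) := by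
          exact Finset.sum_le_sum fun f _ =>
            mul_le_mul_of_nonneg_left (hinner f) (abs_nonneg _)
      _ = M * (SV * SU) := by rw [← Finset.sum_mul, ← hSV]; ring
  have hprod : SV * SU ≤ (Fintype.card ν : ℝ) ^ Fintype.card κ * (F * β ^ Fintype.card κ) := by
    nlinarith [sq_nonneg (SV - SU)]
  refine le_of_mul_le_mul_left (houter.trans ((mul_le_mul_of_nonneg_left hprod hM).trans_eq ?_))
    hFpos
  rw [mul_pow]
  ring

variable [DecidableEq ν] in
/-- A lower bound for hereditary discrepancy from a compression `Vᵀ A U` with orthogonal frames. -/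
theorem factorial_mul_abs_det_le_of_forall_signing {A : Matrix ν ν ℝ} {U V : Matrix ν κ ℝ}
    {β D : ℝ} (hD : 0 ≤ D) (hV : V.transpose * V = Matrix.scalar κ β)
    (hU : U.transpose * U = Matrix.scalar κ β)
    (hA : ∀ J : Finset ν, ∃ ε : ν → ℤˣ, ∀ i, |∑ j ∈ J, A i j * ((ε j : ℤ) : ℝ)| ≤ D) :
    ((Fintype.card κ).factorial : ℝ) * |(V.transpose * (A * U)).det| ≤
      (4 * D * Fintype.card ν * β) ^ Fintype.card κ := by
  refine (factorial_mul_abs_det_le hV hU (M := (4 * D) ^ Fintype.card κ) ?_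
    (by positivity)).trans_eq (by rw [← mul_pow]; ring)
  intro f g
  -- Only injective column choices come from subsets of columns; a repeated column makes the minor
  -- vanish.
  by_cases hg : Function.Injective g
  · refine abs_det_le_of_forall_signing _ hD fun J => ?_
    obtain ⟨ε, hε⟩ := hA (J.image g)
    refine ⟨fun j => ε (g j), fun i => ?_⟩
    have := hε (f i)
    rwa [Finset.sum_image hg.injOn] at this
  · rw [Function.not_injective_iff] at hg
    obtain ⟨a, b, hab, hne⟩ := hg
    rw [Matrix.det_zero_of_column_eq hne fun i => by simp [hab], abs_zero]
    positivity

end CauchyBinet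

/-! ### Haar functions, their prefix sums, and dual Walsh functions -/

section Haar

/-- The step function that is `1` on `[s, s + w)`, `-1` on `[s + w, s + 2w)` and `0` elsewhere. -/
def haarStep (s w p : ℕ) : ℤ :=
  if s ≤ p ∧ p < s + w then 1 else if s + w ≤ p ∧ p < s + 2 * w then -1 else 0

theorem sum_haarStep_mul {s w n : ℕ} (h : s + 2 * w ≤ n) (F : ℕ → ℤ) :
    ∑ p ∈ Finset.range n, haarStep s w p * F p =
      ∑ r ∈ Finset.range w, (F (s + r) - F (s + w + r)) := by
  obtain ⟨m, rfl⟩ : ∃ m, n = s + (w + (w + m)) := ⟨n - (s + 2 * w), by omega⟩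
  rw [Finset.sum_range_add, Finset.sum_range_add, Finset.sum_range_add, Finset.sum_sub_distrib]
  have h1 : ∑ x ∈ Finset.range s, haarStep s w x * F x = 0 := by
    refine Finset.sum_eq_zero fun p hp => ?_
    rw [Finset.mem_range] at hp
    rw [haarStep, if_neg (by omega), if_neg (by omega), zero_mul]
  have h2 : ∑ x ∈ Finset.range w, haarStep s w (s + x) * F (s + x) =
      ∑ r ∈ Finset.range w, F (s + r) := by
    refine Finset.sum_congr rfl fun p hp => ?_
    rw [Finset.mem_range] at hp
    rw [haarStep, if_pos (by omega), one_mul]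
  have h3 : ∑ x ∈ Finset.range w, haarStep s w (s + (w + x)) * F (s + (w + x)) =
      -∑ r ∈ Finset.range w, F (s + w + r) := by
    rw [← Finset.sum_neg_distrib]
    refine Finset.sum_congr rfl fun p hp => ?_
    rw [Finset.mem_range] at hp
    rw [haarStep, if_neg (by omega), if_pos (by omega), neg_one_mul, add_assoc]
  have h4 : ∑ x ∈ Finset.range m, haarStep s w (s + (w + (w + x))) * F (s + (w + (w + x))) = 0 := by
    refine Finset.sum_eq_zero fun p hp => ?_
    rw [haarStep, if_neg (by omega), if_neg (by omega), zero_mul]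
  rw [h1, h2, h3, h4]
  ring

theorem sum_range_haarStep (s w m : ℕ) :
    ∑ p ∈ Finset.range m, haarStep s w p =
      max 0 (min ((m : ℤ) - s) ((s : ℤ) + 2 * w - m)) := by
  induction m with
  | zero => simp
  | succ m ih =>
    rw [Finset.sum_range_succ, ih, haarStep]
    split_ifs <;> omega

/-- The `t`-th Haar function of half-length `2 ^ a`. -/
def haar (a t p : ℕ) : ℤ := haarStep (2 * 2 ^ a * t) (2 ^ a) p

/-- The prefix sums of the Haar function `haar a t`. -/
def tent (a t y : ℕ) : ℤ := ∑ p ∈ Finset.range (y + 1), haar a t p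

/-- A combination of neighbouring Haar functions that has two vanishing moments. -/
def walsh (a t p : ℕ) : ℤ := haar a (2 * t + 1) p - haar a (2 * t) p

theorem sum_haar_mul {a t n : ℕ} (h : 2 * 2 ^ a * (t + 1) ≤ n) (F : ℕ → ℤ) :
    ∑ p ∈ Finset.range n, haar a t p * F p =
      ∑ r ∈ Finset.range (2 ^ a), (F (2 * 2 ^ a * t + r) - F (2 * 2 ^ a * t + 2 ^ a + r)) :=
  sum_haarStep_mul (by rw [mul_add, mul_one] at h; exact h) F

theorem mul_add_le_or_mul_le (B t e : ℕ) : B * t + B ≤ B * e ∨ B * e ≤ B * t := by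
  rcases lt_or_ge t e with h | h
  · left
    calc B * t + B = B * (t + 1) := by ring
      _ ≤ B * e := Nat.mul_le_mul_left _ h
  · exact Or.inr (Nat.mul_le_mul_left _ h)

theorem two_pow_of_lt {a b : ℕ} (h : a < b) : ∃ m, 2 ^ b = 2 * 2 ^ a * m :=
  ⟨2 ^ (b - a - 1), by rw [← pow_succ', ← pow_add]; congr 1; omega⟩

/-- Breakpoints of a strictly coarser Haar function are multiples of the finer block length; at
equal scale, a different Haar function vanishes on the block. -/
theorem haar_eq_on_block {a b t u : ℕ} (hab : a ≤ b) (hne : ¬(a = b ∧ t = u)) {p : ℕ}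
    (h1 : 2 * 2 ^ a * t ≤ p) (h2 : p < 2 * 2 ^ a * t + 2 * 2 ^ a) :
    haar b u p = haar b u (2 * 2 ^ a * t) := by
  simp only [haar, haarStep]
  rcases hab.eq_or_lt with rfl | hlt
  · have htu : t ≠ u := fun h => hne ⟨rfl, h⟩
    have hpos : 0 < 2 * 2 ^ a := by positivity
    have h3 := mul_add_le_or_mul_le (2 * 2 ^ a) t u
    have h4 := mul_add_le_or_mul_le (2 * 2 ^ a) u t
    have h5 : 2 * 2 ^ a * t ≠ 2 * 2 ^ a * u := fun h => htu (Nat.eq_of_mul_eq_mul_left hpos h)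
    generalize 2 * 2 ^ a * t = x at *
    generalize 2 * 2 ^ a * u = y at *
    generalize 2 ^ a = w at *
    split_ifs <;> omega
  · obtain ⟨m, hm⟩ := two_pow_of_lt hlt
    have h3 := mul_add_le_or_mul_le (2 * 2 ^ a) t (2 * m * u)
    have h4 := mul_add_le_or_mul_le (2 * 2 ^ a) t (2 * m * u + m)
    have h5 := mul_add_le_or_mul_le (2 * 2 ^ a) t (2 * m * u + 2 * m)
    have e1 : 2 * 2 ^ b * u = 2 * 2 ^ a * (2 * m * u) := by rw [hm]; ring
    have e2 : 2 * 2 ^ a * (2 * m * u + m) = 2 * 2 ^ b * u + 2 ^ b := by rw [hm]; ring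
    have e3 : 2 * 2 ^ a * (2 * m * u + 2 * m) = 2 * 2 ^ b * u + 2 * 2 ^ b := by rw [hm]; ring
    rw [← e1] at h3
    rw [e2] at h4
    rw [e3] at h5
    clear e1 e2 e3 hm
    have hpos : 0 < 2 ^ a := by positivity
    generalize 2 * 2 ^ a * t = x at *
    generalize 2 * 2 ^ b * u = y at *
    generalize 2 ^ a = w at *
    generalize 2 ^ b = w' at *
    split_ifs <;> omega

theorem sum_haar_mul_haar_of_le {a b t u n : ℕ} (hab : a ≤ b) (hne : ¬(a = b ∧ t = u))
    (h : 2 * 2 ^ a * (t + 1) ≤ n) : ∑ p ∈ Finset.range n, haar a t p * haar b u p = 0 := by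
  rw [sum_haar_mul h]
  refine Finset.sum_eq_zero fun r hr => ?_
  rw [Finset.mem_range] at hr
  rw [haar_eq_on_block hab hne (p := 2 * 2 ^ a * t + r) (by omega) (by omega),
    haar_eq_on_block hab hne (p := 2 * 2 ^ a * t + 2 ^ a + r) (by omega) (by omega), sub_self]

theorem sum_haar_mul_haar {a b t u n : ℕ} (h : 2 * 2 ^ a * (t + 1) ≤ n)
    (h' : 2 * 2 ^ b * (u + 1) ≤ n) :
    ∑ p ∈ Finset.range n, haar a t p * haar b u p = if a = b ∧ t = u then 2 * 2 ^ a else 0 := by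
  split_ifs with heq
  · obtain ⟨rfl, rfl⟩ := heq
    rw [sum_haar_mul h]
    have hr (r : ℕ) (hr : r ∈ Finset.range (2 ^ a)) :
        haar a t (2 * 2 ^ a * t + r) - haar a t (2 * 2 ^ a * t + 2 ^ a + r) = 2 := by
      rw [Finset.mem_range] at hr
      rw [haar, haarStep, haar, haarStep, if_pos (by omega), if_neg (by omega), if_pos (by omega)]
      norm_num
    rw [Finset.sum_congr rfl hr]
    simp [mul_comm]
  · rcases le_total a b with hab | hab
    · exact sum_haar_mul_haar_of_le hab heq h
    · simp only [mul_comm (haar a t _)]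
      exact sum_haar_mul_haar_of_le hab (fun h => heq ⟨h.1.symm, h.2.symm⟩) h'

theorem sum_walsh_mul_walsh {a b t u n : ℕ} (h : 4 * 2 ^ a * (t + 1) ≤ n)
    (h' : 4 * 2 ^ b * (u + 1) ≤ n) :
    ∑ p ∈ Finset.range n, walsh a t p * walsh b u p = if a = b ∧ t = u then 4 * 2 ^ a else 0 := by
  have h1 : 2 * 2 ^ a * (2 * t + 1 + 1) ≤ n := by linarith
  have h2 : 2 * 2 ^ a * (2 * t + 1) ≤ n := by nlinarith [Nat.zero_le (2 ^ a)]
  have h3 : 2 * 2 ^ b * (2 * u + 1 + 1) ≤ n := by linarith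
  have h4 : 2 * 2 ^ b * (2 * u + 1) ≤ n := by nlinarith [Nat.zero_le (2 ^ b)]
  simp only [walsh, sub_mul, mul_sub, Finset.sum_sub_distrib]
  rw [sum_haar_mul_haar h1 h3, sum_haar_mul_haar h1 h4, sum_haar_mul_haar h2 h3,
    sum_haar_mul_haar h2 h4]
  by_cases hab : a = b
  · subst hab
    by_cases htu : t = u
    · subst htu
      simp
      ring
    · rw [if_neg (by omega), if_neg (by omega), if_neg (by omega), if_neg (by omega),
        if_neg (by omega)]
      norm_num
  · simp [hab]

theorem tent_succ_eq (b u y : ℕ) : tent (b + 1) u y =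
    max 0 (min ((y : ℤ) + 1 - (4 * 2 ^ b * u : ℕ))
      (((4 * 2 ^ b * u : ℕ) : ℤ) + 2 * (2 * 2 ^ b : ℕ) - (y + 1))) := by
  have e1 : 2 * 2 ^ (b + 1) * u = 4 * 2 ^ b * u := by ring
  have e2 : 2 ^ (b + 1) = 2 * 2 ^ b := by ring
  simp only [tent, haar]
  rw [sum_range_haarStep, e1, e2]
  push_cast
  rfl

theorem sum_walsh_mul {a t n : ℕ} (h : 4 * 2 ^ a * (t + 1) ≤ n) (F : ℕ → ℤ) :
    ∑ p ∈ Finset.range n, walsh a t p * F p = ∑ r ∈ Finset.range (2 ^ a),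
      (F (4 * 2 ^ a * t + 2 * 2 ^ a + r) - F (4 * 2 ^ a * t + 3 * 2 ^ a + r) -
        F (4 * 2 ^ a * t + r) + F (4 * 2 ^ a * t + 2 ^ a + r)) := by
  simp only [walsh, sub_mul, Finset.sum_sub_distrib]
  rw [sum_haar_mul (by linarith), sum_haar_mul (by nlinarith [Nat.zero_le (2 ^ a)]),
    ← Finset.sum_sub_distrib]
  refine Finset.sum_congr rfl fun r _ => ?_
  rw [show 2 * 2 ^ a * (2 * t + 1) + r = 4 * 2 ^ a * t + 2 * 2 ^ a + r by ring,
    show 2 * 2 ^ a * (2 * t + 1) + 2 ^ a + r = 4 * 2 ^ a * t + 3 * 2 ^ a + r by ring,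
    show 2 * 2 ^ a * (2 * t) = 4 * 2 ^ a * t by ring]
  ring

theorem sum_walsh_mul_tent_self {a t n : ℕ} (h : 4 * 2 ^ a * (t + 1) ≤ n) :
    ∑ p ∈ Finset.range n, walsh a t p * tent (a + 1) t p = 2 * (2 ^ a) ^ 2 := by
  rw [sum_walsh_mul h]
  have hr (r : ℕ) (hr : r ∈ Finset.range (2 ^ a)) :
      tent (a + 1) t (4 * 2 ^ a * t + 2 * 2 ^ a + r) -
        tent (a + 1) t (4 * 2 ^ a * t + 3 * 2 ^ a + r) - tent (a + 1) t (4 * 2 ^ a * t + r) +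
        tent (a + 1) t (4 * 2 ^ a * t + 2 ^ a + r) = 2 * ((2 ^ a : ℕ) : ℤ) := by
    rw [Finset.mem_range] at hr
    simp only [tent_succ_eq]
    generalize 4 * 2 ^ a * t = x
    generalize 2 ^ a = w at *
    omega
  rw [Finset.sum_congr rfl hr]
  simp
  ring

/-- The Walsh function has signs (-, +, +, -) on the quarters of its block and annihilates affine
functions. A coarser tent is affine on that block, and another tent of the matching scale vanishes
there. For a > b there is no such vanishing; fixing the total level compensates for this. -/
theorem sum_walsh_mul_tent_of_le {a b t u n : ℕ} (h : 4 * 2 ^ a * (t + 1) ≤ n) (hab : a ≤ b)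
    (hne : ¬(a = b ∧ t = u)) :
    ∑ p ∈ Finset.range n, walsh a t p * tent (b + 1) u p = 0 := by
  rw [sum_walsh_mul h]
  refine Finset.sum_eq_zero fun r hr => ?_
  rw [Finset.mem_range] at hr
  simp only [tent_succ_eq]
  rcases hab.eq_or_lt with rfl | hlt
  · have htu : t ≠ u := fun h => hne ⟨rfl, h⟩
    have hpos : 0 < 4 * 2 ^ a := by positivity
    have h3 := mul_add_le_or_mul_le (4 * 2 ^ a) t u
    have h4 := mul_add_le_or_mul_le (4 * 2 ^ a) u t
    have h5 : 4 * 2 ^ a * t ≠ 4 * 2 ^ a * u := fun h => htu (Nat.eq_of_mul_eq_mul_left hpos h)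
    clear h
    generalize 4 * 2 ^ a * t = x at *
    generalize 4 * 2 ^ a * u = y at *
    generalize 2 ^ a = w at *
    omega
  · obtain ⟨m, hm⟩ := two_pow_of_lt hlt
    have h3 := mul_add_le_or_mul_le (4 * 2 ^ a) t (2 * m * u)
    have h4 := mul_add_le_or_mul_le (4 * 2 ^ a) t (2 * m * u + m)
    have h5 := mul_add_le_or_mul_le (4 * 2 ^ a) t (2 * m * u + 2 * m)
    have e1 : 4 * 2 ^ b * u = 4 * 2 ^ a * (2 * m * u) := by rw [hm]; ring
    have e2 : 4 * 2 ^ a * (2 * m * u + m) = 4 * 2 ^ b * u + 2 * 2 ^ b := by rw [hm]; ring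
    have e3 : 4 * 2 ^ a * (2 * m * u + 2 * m) = 4 * 2 ^ b * u + 4 * 2 ^ b := by rw [hm]; ring
    rw [← e1] at h3
    rw [e2] at h4
    rw [e3] at h5
    clear e1 e2 e3 hm h
    generalize 4 * 2 ^ a * t = x at *
    generalize 4 * 2 ^ b * u = y at *
    generalize 2 ^ a = w at *
    generalize 2 ^ b = w' at *
    omega

end Haar

/-! ### Lower bound on the grid -/

section LowerBound

/-- Indices of tensor products of `d` Haar functions on `[0, 2 ^ (S + 2))` of total level `S`. -/
abbrev HaarIndex (d S : ℕ) : Type :=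
  {c : Fin d → Fin (S + 1) × Fin (2 ^ S) //
    ∑ i, ((c i).1 : ℕ) = S ∧ ∀ i, ((c i).2 : ℕ) < 2 ^ (S - ((c i).1 : ℕ))}

/-- The last e levels range freely over 0, …, T, and the first is whatever remains of S = eT. Each
such choice leaves ∏ 2^(S - aᵢ) = 2^(Se) positions. -/
theorem card_haarIndex_ge (e T : ℕ) :
    (T + 1) ^ e * 2 ^ (e * T * e) ≤ Fintype.card (HaarIndex (e + 1) (e * T)) := by
  set S := e * T with hS
  let a (b : Fin e → Fin (T + 1)) : Fin (e + 1) → ℕ := Fin.cons (S - ∑ i, (b i : ℕ)) fun i => b i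
  have hsum (b : Fin e → Fin (T + 1)) : ∑ i, a b i = S := by
    have h1 : ∑ i, (b i : ℕ) ≤ S := by
      calc ∑ i, (b i : ℕ) ≤ ∑ _i : Fin e, T :=
            Finset.sum_le_sum fun i _ => Nat.le_of_lt_succ (b i).2
        _ = S := by simp [hS]
    rw [Fin.sum_univ_succ]
    simp only [a, Fin.cons_zero, Fin.cons_succ]
    omega
  have hle (b : Fin e → Fin (T + 1)) (i : Fin (e + 1)) : a b i ≤ S := by
    rw [← hsum b]
    exact Finset.single_le_sum (f := a b) (fun _ _ => Nat.zero_le _) (Finset.mem_univ i)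
  let F : (Σ b : Fin e → Fin (T + 1), ∀ i, Fin (2 ^ (S - a b i))) → HaarIndex (e + 1) S :=
    fun x => ⟨fun i => (⟨a x.1 i, Nat.lt_succ_of_le (hle x.1 i)⟩,
      ⟨x.2 i, (x.2 i).2.trans_le (Nat.pow_le_pow_right (by norm_num) (Nat.sub_le _ _))⟩),
      hsum x.1, fun i => (x.2 i).2⟩
  have hF : Function.Injective F := by
    rintro ⟨b, t⟩ ⟨b', t'⟩ hx
    have hx' := congrArg Subtype.val hx
    have hb : b = b' := by
      funext i
      have h1 := congrArg (fun z => (z.1 : ℕ)) (congrFun hx' i.succ)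
      simp only [F, a, Fin.cons_succ] at h1
      exact Fin.ext h1
    subst hb
    have ht : t = t' := by
      funext i
      have h1 := congrArg (fun z => (z.2 : ℕ)) (congrFun hx' i)
      exact Fin.ext h1
    rw [ht]
  refine le_trans (le_of_eq ?_) (Fintype.card_le_of_injective F hF)
  rw [Fintype.card_sigma]
  have hcard (b : Fin e → Fin (T + 1)) :
      Fintype.card (∀ i, Fin (2 ^ (S - a b i))) = 2 ^ (S * e) := by
    rw [Fintype.card_pi]
    simp only [Fintype.card_fin]
    rw [Finset.prod_pow_eq_pow_sum]
    congr 1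
    have h1 : ∑ i, (S - a b i) + ∑ i, a b i = S * e + S := by
      rw [← Finset.sum_add_distrib, Finset.sum_congr rfl fun i _ => Nat.sub_add_cancel (hle b i)]
      simp
      ring
    rw [hsum b] at h1
    omega
  simp [hcard]

/-- The tensor product of Walsh functions with index `c`, as a matrix column. -/
def walshFrame (d S : ℕ) : Matrix (Fin d → Fin (2 ^ (S + 2))) (HaarIndex d S) ℝ :=
  fun y c => ∏ i, (walsh (c.1 i).1 (c.1 i).2 (y i) : ℝ)

/-- The tensor product of Haar functions with index `c`, as a matrix column. -/
def haarFrame (d S : ℕ) : Matrix (Fin d → Fin (2 ^ (S + 2))) (HaarIndex d S) ℝ :=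
  fun y c => ∏ i, (haar ((c.1 i).1 + 1) (c.1 i).2 (y i) : ℝ)

/-- The incidence matrix of grid points and boxes anchored at the origin. -/
def anchoredMatrix (d n : ℕ) : Matrix (Fin d → Fin n) (Fin d → Fin n) ℝ :=
  fun y p => if ∀ i, p i ≤ y i then 1 else 0

theorem HaarIndex.mul_le {d S : ℕ} (c : HaarIndex d S) (i : Fin d) :
    4 * 2 ^ ((c.1 i).1 : ℕ) * (((c.1 i).2 : ℕ) + 1) ≤ 2 ^ (S + 2) := by
  have h1 := c.2.2 i
  have h2 : ((c.1 i).1 : ℕ) ≤ S := Nat.le_of_lt_succ (c.1 i).1.2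
  calc 4 * 2 ^ ((c.1 i).1 : ℕ) * (((c.1 i).2 : ℕ) + 1)
      ≤ 4 * 2 ^ ((c.1 i).1 : ℕ) * 2 ^ (S - ((c.1 i).1 : ℕ)) := Nat.mul_le_mul_left _ h1
    _ = 2 ^ (S + 2) := by
        rw [mul_assoc, ← pow_add, Nat.add_sub_cancel' h2, pow_add]
        ring

/-- The levels of both indices have the same sum, so they cannot be strictly larger for c in every
coordinate where the two differ. In the coordinate found here, orthogonality applies in the only
direction available for tents. -/
theorem HaarIndex.exists_ne {d S : ℕ} {c c' : HaarIndex d S} (h : c ≠ c') :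
    ∃ i, ((c.1 i).1 : ℕ) ≤ (c'.1 i).1 ∧
      ¬(((c.1 i).1 : ℕ) = (c'.1 i).1 ∧ ((c.1 i).2 : ℕ) = (c'.1 i).2) := by
  by_contra! hcon
  have hle (i : Fin d) : ((c'.1 i).1 : ℕ) ≤ (c.1 i).1 := by
    rcases le_total ((c.1 i).1 : ℕ) (c'.1 i).1 with h1 | h1
    · exact (hcon i h1).1.ge
    · exact h1
  have heq : ∀ i ∈ Finset.univ, ((c'.1 i).1 : ℕ) = (c.1 i).1 :=
    (Finset.sum_eq_sum_iff_of_le fun i _ => hle i).1 (c'.2.1.trans c.2.1.symm)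
  refine h (Subtype.ext (funext fun i => Prod.ext (Fin.ext ?_) (Fin.ext ?_)))
  · exact (heq i (Finset.mem_univ i)).symm
  · exact (hcon i (heq i (Finset.mem_univ i)).ge).2

theorem sum_fin_cast {n : ℕ} {f g : ℕ → ℤ} {k : ℤ} (h : ∑ p ∈ Finset.range n, f p * g p = k) :
    ∑ p : Fin n, (f p : ℝ) * (g p : ℝ) = k := by
  rw [← h, Fin.sum_univ_eq_sum_range (fun p => (f p : ℝ) * (g p : ℝ))]
  push_cast
  rfl

theorem HaarIndex.prod_four_mul {d S : ℕ} (c : HaarIndex d S) :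
    ∏ i, (4 * 2 ^ ((c.1 i).1 : ℕ) : ℝ) = 4 ^ d * 2 ^ S := by
  rw [Finset.prod_mul_distrib, Finset.prod_pow_eq_pow_sum, c.2.1]
  simp

theorem walshFrame_transpose_mul_self (d S : ℕ) :
    (walshFrame d S).transpose * walshFrame d S = Matrix.scalar _ (4 ^ d * 2 ^ S) := by
  ext c c'
  rw [Matrix.mul_apply, Matrix.scalar_apply, Matrix.diagonal_apply]
  simp only [Matrix.transpose_apply, walshFrame, ← Finset.prod_mul_distrib]
  rw [sum_prod_apply fun i (p : Fin (2 ^ (S + 2))) =>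
    (walsh (c.1 i).1 (c.1 i).2 p : ℝ) * (walsh (c'.1 i).1 (c'.1 i).2 p : ℝ)]
  simp only [sum_fin_cast (sum_walsh_mul_walsh (c.mul_le _) (c'.mul_le _))]
  split_ifs with h
  · subst h
    rw [← c.prod_four_mul]
    simp
  · obtain ⟨i, -, hi⟩ := HaarIndex.exists_ne h
    exact Finset.prod_eq_zero (Finset.mem_univ i) (by rw [if_neg hi]; simp)

theorem haarFrame_transpose_mul_self (d S : ℕ) :
    (haarFrame d S).transpose * haarFrame d S = Matrix.scalar _ (4 ^ d * 2 ^ S) := by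
  have hle (c : HaarIndex d S) (i : Fin d) :
      2 * 2 ^ (((c.1 i).1 : ℕ) + 1) * (((c.1 i).2 : ℕ) + 1) ≤ 2 ^ (S + 2) := by
    have := c.mul_le i
    rw [pow_succ]
    linarith
  ext c c'
  rw [Matrix.mul_apply, Matrix.scalar_apply, Matrix.diagonal_apply]
  simp only [Matrix.transpose_apply, haarFrame, ← Finset.prod_mul_distrib]
  rw [sum_prod_apply fun i (p : Fin (2 ^ (S + 2))) =>
    (haar ((c.1 i).1 + 1) (c.1 i).2 p : ℝ) * (haar ((c'.1 i).1 + 1) (c'.1 i).2 p : ℝ)]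
  simp only [sum_fin_cast (sum_haar_mul_haar (hle c _) (hle c' _))]
  split_ifs with h
  · subst h
    rw [← c.prod_four_mul]
    refine Finset.prod_congr rfl fun i _ => ?_
    rw [if_pos ⟨rfl, rfl⟩]
    push_cast
    ring
  · obtain ⟨i, -, hi⟩ := HaarIndex.exists_ne h
    exact Finset.prod_eq_zero (Finset.mem_univ i) (by rw [if_neg (by omega)]; simp)

theorem anchoredMatrix_mul_haarFrame (d S : ℕ) (y : Fin d → Fin (2 ^ (S + 2)))
    (c : HaarIndex d S) : (anchoredMatrix d (2 ^ (S + 2)) * haarFrame d S) y c =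
      ∏ i, (tent ((c.1 i).1 + 1) (c.1 i).2 (y i) : ℝ) := by
  rw [Matrix.mul_apply]
  have h1 (p : Fin d → Fin (2 ^ (S + 2))) :
      anchoredMatrix d (2 ^ (S + 2)) y p * haarFrame d S p c =
      ∏ i, (if p i ≤ y i then (1 : ℝ) else 0) * (haar ((c.1 i).1 + 1) (c.1 i).2 (p i) : ℝ) := by
    rw [anchoredMatrix, haarFrame, Finset.prod_mul_distrib, Finset.prod_boole]
    simp
  simp only [h1]
  rw [sum_prod_apply fun i (p : Fin (2 ^ (S + 2))) =>
    (if p ≤ y i then (1 : ℝ) else 0) * (haar ((c.1 i).1 + 1) (c.1 i).2 p : ℝ)]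
  refine Finset.prod_congr rfl fun i _ => ?_
  simp only [Fin.le_def]
  rw [Fin.sum_univ_eq_sum_range
    (fun p => (if p ≤ (y i : ℕ) then (1 : ℝ) else 0) * (haar ((c.1 i).1 + 1) (c.1 i).2 p : ℝ))]
  simp only [ite_mul, one_mul, zero_mul]
  rw [← Finset.sum_filter, tent, Int.cast_sum]
  refine Finset.sum_congr ?_ fun _ _ => rfl
  ext p
  have := (y i).2
  simp only [Finset.mem_filter, Finset.mem_range]
  omega

/-- Each entry factors over coordinates into Walsh–tent pairings. Off the diagonal
`HaarIndex.exists_ne` supplies a zero factor; on it the factors 2·4^a multiply to a constant because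
the levels sum to S. -/
theorem walshFrame_transpose_mul_anchoredMatrix_mul (d S : ℕ) :
    (walshFrame d S).transpose * (anchoredMatrix d (2 ^ (S + 2)) * haarFrame d S) =
      Matrix.scalar _ (2 ^ d * 4 ^ S) := by
  ext c c'
  rw [Matrix.mul_apply, Matrix.scalar_apply, Matrix.diagonal_apply]
  simp only [anchoredMatrix_mul_haarFrame, Matrix.transpose_apply, walshFrame,
    ← Finset.prod_mul_distrib]
  rw [sum_prod_apply fun i (p : Fin (2 ^ (S + 2))) =>
    (walsh (c.1 i).1 (c.1 i).2 p : ℝ) * (tent ((c'.1 i).1 + 1) (c'.1 i).2 p : ℝ)]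
  split_ifs with h
  · subst h
    simp only [sum_fin_cast (sum_walsh_mul_tent_self (c.mul_le _))]
    push_cast
    rw [Finset.prod_mul_distrib, Finset.prod_pow, Finset.prod_pow_eq_pow_sum, c.2.1, ← pow_mul,
      mul_comm S 2, pow_mul]
    norm_num
  · obtain ⟨i, hi1, hi2⟩ := HaarIndex.exists_ne h
    refine Finset.prod_eq_zero (Finset.mem_univ i) ?_
    rw [sum_fin_cast (sum_walsh_mul_tent_of_le (c.mul_le i) hi1 hi2), Int.cast_zero]

theorem pow_le_of_forall_signing_anchoredMatrix (e T : ℕ) {D : ℝ} (hD : 0 ≤ D)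
    (hA : ∀ J : Finset (Fin (e + 1) → Fin (2 ^ (e * T + 2))),
      ∃ ε : (Fin (e + 1) → Fin (2 ^ (e * T + 2))) → ℤˣ,
      ∀ i, |∑ j ∈ J, anchoredMatrix (e + 1) (2 ^ (e * T + 2)) i j * ((ε j : ℤ) : ℝ)| ≤ D) :
    ((T : ℝ) + 1) ^ e ≤ 12 * 8 ^ (e + 1) * D := by
  set S := e * T with hS
  have hmain := factorial_mul_abs_det_le_of_forall_signing hD
    (walshFrame_transpose_mul_self (e + 1) S) (haarFrame_transpose_mul_self (e + 1) S) hA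
  have hk := card_haarIndex_ge e T
  rw [← hS] at hk
  set k := Fintype.card (HaarIndex (e + 1) S) with hkdef
  have hk0 : 0 < k := lt_of_lt_of_le (by positivity) hk
  rw [walshFrame_transpose_mul_anchoredMatrix_mul, Matrix.scalar_apply, Matrix.det_diagonal,
    Finset.prod_const, Finset.card_univ, ← hkdef, abs_of_pos (by positivity)] at hmain
  -- k^k ≤ exp(k) k! replaces the factorial, so that a k-th root can be taken.
  have hexp := Real.pow_div_factorial_le_exp (k : ℝ) (Nat.cast_nonneg k) k
  rw [div_le_iff₀ (by exact_mod_cast Nat.factorial_pos k)] at hexp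
  have he : Real.exp (k : ℝ) = Real.exp 1 ^ k := by rw [← Real.exp_nat_mul, mul_one]
  rw [he] at hexp
  have hpow : ((k : ℝ) * (2 ^ (e + 1) * 4 ^ S)) ^ k ≤ (Real.exp 1 *
      (4 * D * (Fintype.card (Fin (e + 1) → Fin (2 ^ (S + 2))) : ℝ) *
        (4 ^ (e + 1) * 2 ^ S))) ^ k := by
    rw [mul_pow, mul_pow (Real.exp 1)]
    calc (k : ℝ) ^ k * (2 ^ (e + 1) * 4 ^ S) ^ k
        ≤ (Real.exp 1 ^ k * k.factorial) * (2 ^ (e + 1) * 4 ^ S) ^ k := by gcongr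
      _ = Real.exp 1 ^ k * (k.factorial * (2 ^ (e + 1) * 4 ^ S) ^ k) := by ring
      _ ≤ _ := by gcongr
  have hroot := le_of_pow_le_pow_left₀ hk0.ne' (by positivity) hpow
  have hk' : ((T : ℝ) + 1) ^ e * 2 ^ (S * e) ≤ k := by exact_mod_cast hk
  have he3 : Real.exp 1 ≤ 3 := Real.exp_one_lt_three.le
  have hcard : (Fintype.card (Fin (e + 1) → Fin (2 ^ (S + 2))) : ℝ) =
      2 ^ (S * e) * 2 ^ S * 4 ^ (e + 1) := by
    simp only [Fintype.card_pi, Fintype.card_fin, Finset.prod_const, Finset.card_univ]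
    push_cast
    rw [← pow_mul, ← pow_add, show (4 : ℝ) = 2 ^ 2 by norm_num, ← pow_mul, ← pow_add]
    congr 1
    ring
  rw [hcard] at hroot
  have h4 : (4 : ℝ) ^ S = 2 ^ S * 2 ^ S := by rw [← mul_pow]; norm_num
  have h16 : (4 : ℝ) ^ (e + 1) * 4 ^ (e + 1) = 8 ^ (e + 1) * 2 ^ (e + 1) := by
    rw [← mul_pow, ← mul_pow]; norm_num
  have hfin : (((T : ℝ) + 1) ^ e) * (2 ^ (S * e) * (2 ^ (e + 1) * 4 ^ S)) ≤
      (12 * 8 ^ (e + 1) * D) * (2 ^ (S * e) * (2 ^ (e + 1) * 4 ^ S)) := by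
    calc (((T : ℝ) + 1) ^ e) * (2 ^ (S * e) * (2 ^ (e + 1) * 4 ^ S))
        = (((T : ℝ) + 1) ^ e * 2 ^ (S * e)) * (2 ^ (e + 1) * 4 ^ S) := by ring
      _ ≤ k * (2 ^ (e + 1) * 4 ^ S) := by gcongr
      _ ≤ _ := hroot
      _ ≤ 3 * (4 * D * (2 ^ (S * e) * 2 ^ S * 4 ^ (e + 1)) * (4 ^ (e + 1) * 2 ^ S)) := by gcongr
      _ = 12 * D * (4 ^ (e + 1) * 4 ^ (e + 1)) * (2 ^ (S * e) * (2 ^ S * 2 ^ S)) := by ring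
      _ = _ := by rw [h16, h4]; ring
  exact le_of_mul_le_mul_right hfin (by positivity)

/-- The point of `ℝ^d` with the given natural coordinates. -/
def gridPoint {d n : ℕ} (p : Fin d → Fin n) : Fin d → ℝ := fun i => ((p i : ℕ) : ℝ)

theorem gridPoint_injective {d n : ℕ} :
    Function.Injective (gridPoint : (Fin d → Fin n) → Fin d → ℝ) := by
  intro p q h
  funext i
  exact Fin.ext (Nat.cast_injective (R := ℝ) (congrFun h i))

open Classical in
theorem exists_signing_anchoredMatrix {d n : ℕ} (J : Finset (Fin d → Fin n)) :
    ∃ ε : (Fin d → Fin n) → ℤˣ, ∀ y,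
      |∑ p ∈ J, anchoredMatrix d n y p * ((ε p : ℤ) : ℝ)| ≤
        disc (inducedBoxes (J.image gridPoint)) := by
  obtain ⟨x, hx⟩ := exists_coloring_abs_sum_le_disc (J.image gridPoint)
  refine ⟨fun p => x (gridPoint p), fun y => ?_⟩
  have h := hx 0 (gridPoint y) fun i => Nat.cast_nonneg _
  rw [Finset.sum_filter, Finset.sum_image gridPoint_injective.injOn] at h
  convert h using 3 with p
  simp [anchoredMatrix, gridPoint]

/-- The worst subset of the grid bounds the signings of all subsets at once, which is the hereditary
hypothesis of the determinant bound. -/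
theorem exists_large_disc (e T : ℕ) :
    ∃ P : Finset (Fin (e + 1) → ℝ), P.card ≤ (2 ^ (e * T + 2)) ^ (e + 1) ∧
      ((T : ℝ) + 1) ^ e ≤ 12 * 8 ^ (e + 1) * disc (inducedBoxes P) := by
  classical
  obtain ⟨J, -, hJ⟩ := Finset.exists_max_image
    (Finset.univ : Finset (Finset (Fin (e + 1) → Fin (2 ^ (e * T + 2)))))
    (fun J => disc (inducedBoxes (J.image gridPoint))) ⟨∅, Finset.mem_univ _⟩
  refine ⟨J.image gridPoint, ?_, ?_⟩
  · refine Finset.card_image_le.trans ((Finset.card_le_univ J).trans_eq ?_)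
    simp
  · refine pow_le_of_forall_signing_anchoredMatrix e T (Nat.cast_nonneg _) fun J' => ?_
    obtain ⟨ε, hε⟩ := exists_signing_anchoredMatrix J'
    exact ⟨ε, fun y => (hε y).trans (by exact_mod_cast hJ J' (Finset.mem_univ _))⟩

theorem disc_inducedBoxes_le_card {d : ℕ} (P : Finset (Fin d → ℝ)) :
    disc (inducedBoxes P) ≤ P.card := by
  classical
  have h : (disc (inducedBoxes P) : ℝ) ≤ P.card := by
    refine disc_inducedBoxes_le P 1 (Nat.cast_nonneg _) fun a b _ => ?_
    simp only [Pi.one_apply, Units.val_one, Int.cast_one, Finset.sum_const, nsmul_eq_mul, mul_one,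
      Nat.abs_cast]
    exact_mod_cast Finset.card_filter_le _ _
  exact_mod_cast h

theorem exists_disc_inducedBoxes_lower_bound {e : ℕ} (he : 1 ≤ e) :
    ∃ c : ℝ, 0 < c ∧ {n : ℕ | ∃ P : Finset (Fin (e + 1) → ℝ), P.card = n ∧
      c * Real.log n ^ e ≤ (disc (inducedBoxes P) : ℝ)}.Infinite := by
  set K : ℝ := 12 * 8 ^ (e + 1) with hK
  have hK0 : 0 < K := by positivity
  -- Chosen so that log |P| ≤ (e + 1)(eT + 2) ≤ L (T + 1).
  set L : ℝ := (e + 1) * (e + 2) with hL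
  have hL0 : 0 < L := by positivity
  refine ⟨(K * L ^ e)⁻¹, by positivity, Set.infinite_of_forall_exists_gt fun m => ?_⟩
  obtain ⟨T, hT⟩ := exists_nat_gt (K * m)
  obtain ⟨P, hcard, hP⟩ := exists_large_disc e T
  refine ⟨P.card, ⟨P, rfl, ?_⟩, ?_⟩
  · have hlog : Real.log P.card ≤ L * (T + 1) := by
      rcases P.card.eq_zero_or_pos with h0 | hpos
      · rw [h0, Nat.cast_zero, Real.log_zero]; positivity
      · have hc : (P.card : ℝ) ≤ ((2 : ℝ) ^ (e * T + 2)) ^ (e + 1) := by exact_mod_cast hcard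
        have h1 := Real.log_le_log (by exact_mod_cast hpos) hc
        rw [Real.log_pow, Real.log_pow] at h1
        push_cast at h1
        have h2 : Real.log 2 ≤ 1 := by have := Real.log_two_lt_d9; linarith
        calc Real.log P.card ≤ _ := h1
          _ ≤ ((e : ℝ) + 1) * ((e * T + 2) * 1) := by gcongr
          _ ≤ ((e : ℝ) + 1) * ((e + 2) * (T + 1)) := by
              refine mul_le_mul_of_nonneg_left ?_ (by positivity)
              nlinarith [Nat.cast_nonneg (α := ℝ) e, Nat.cast_nonneg (α := ℝ) T]
          _ = L * (T + 1) := by rw [hL]; ring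
    rw [inv_mul_le_iff₀ (by positivity)]
    calc Real.log P.card ^ e ≤ (L * (T + 1)) ^ e :=
          pow_le_pow_left₀ (Real.log_natCast_nonneg _) hlog e
      _ = L ^ e * (T + 1) ^ e := mul_pow _ _ _
      _ ≤ L ^ e * (K * disc (inducedBoxes P)) := by gcongr
      _ = _ := by ring
  -- Infinitely many sizes occur because the discrepancy, unbounded in T, never exceeds the number
  -- of points; e ≥ 1 enters here.
  · have h1 : (T : ℝ) + 1 ≤ (T + 1) ^ e :=
      le_self_pow₀ (by linarith [Nat.cast_nonneg (α := ℝ) T]) (by omega)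
    have h2 : (disc (inducedBoxes P) : ℝ) ≤ P.card := by
      exact_mod_cast disc_inducedBoxes_le_card P
    have h3 : K * m < K * P.card := by nlinarith
    exact_mod_cast lt_of_mul_lt_mul_left h3 hK0.le

end LowerBound

theorem theorem1 (d : ℕ) (hd : 2 ≤ d) :
    (∃ c : ℝ, 0 < c ∧
      {n : ℕ | ∃ P : Finset (Fin d → ℝ), P.card = n ∧
        c * Real.log n ^ (d - 1) ≤ (disc (inducedBoxes P) : ℝ)}.Infinite) ∧
    (∃ C : ℝ, 0 < C ∧ ∀ n : ℕ, 2 ≤ n → ∀ P : Finset (Fin d → ℝ), P.card = n →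
      (disc (inducedBoxes P) : ℝ) ≤ C * Real.log n ^ ((d : ℝ) + 1 / 2)) := by
  refine ⟨?_, exists_disc_inducedBoxes_upper_bound d⟩
  obtain ⟨e, rfl⟩ : ∃ e, d = e + 1 := ⟨d - 1, by omega⟩
  exact exists_disc_inducedBoxes_lower_bound (by omega)
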